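/- Let $0\le k\le n$, let $U\subset\mathbb C^n$ be open with coordinates $Z_1,\dots,Z_n$ (a coordinate chart of a complex manifold $X$ over which the line bundle $\mathcal L$ is trivialised), and let $x\in U$. Let $$\omega=\sum_{|I|=n-k}a_I\,dZ_I,\qquad a_I\in\mathcal O(U),$$ be a holomorphic $(n-k)$-form on $U$ (a local representative of a Pfaff system of dimension $k$), where $I$ runs over the increasing multi-indices of length $n-k$. Let $V$ be a reduced complete intersection near $x$ with local equation $f_1=\dots=f_{n-k}=0$, $f_i\in\mathcal O(U)$; that is, near $x$ the set $V$ is $\{f_1=\dots=f_{n-k}=0\}$, and $f_1,\dots,f_{n-k}$ generate the ideal of $V$ in the ring $\mathcal O_x$ of germs. Let $S$ be an irreducible component of the germ at $x$ of $\mathrm{Sing}(\omega)\cap V=\{z\in V:\omega(z)=0\}$, and assume that $S$ has codimension one in $V$. For an irreducible component $V_j\supset S$ of the germ of $V$ at $x$ with ideal $Q_j\subset P=I(S)$, and a germ $h$ not identically zero on $V_j$, let $\mathrm{ord}_S(h|_{V_j})$ be the length of $A_j/hA_j$, where $A_j=(\mathcal O_x/Q_j)_P$, and put $\mathrm{ord}_S(h|_V)=\sum_{V_j\supset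 S}\mathrm{ord}_S(h|_{V_j})$. The GSV index is defined by $$\mathrm{GSV}(\omega,V,S)=\sum_{V_j\supset S}\big(\mathrm{ord}_S(\xi|_{V_j})-\mathrm{ord}_S(g|_{V_j})\big)$$ for any local equation $f'_1=\dots=f'_{n-k}=0$ of $V$ at $x$ and any decomposition $$g\,\omega=\xi\,df'_1\wedge\dots\wedge df'_{n-k}+\sum_i f'_i\,\eta_i$$ near $x$ with $g,\xi$ holomorphic functions, $\eta_i$ holomorphic $(n-k)$-forms, and $g$ not identically zero on any $V_j\supset S$. Let $I$ be a multi-index such that the minor $\Delta_I=\det(\partial f_i/\partial Z_{I_j})_{i,j}$ of $\mathrm{Jac}(f_1,\dots,f_{n-k})$ does not vanish identically on any component $V_j\supset S$. Then: 1. If $V$ is invariant by $\omega$, in the sense that $\iota_v\omega=0$ for every vector $v$ tangent to $V$ at a point of $V$ near $x$ where $df_1,\dots,df_{n-k}$ are linearly independent, then such a decomposition exists, so that the GSV index is defined. 2. Whenever such a decomposition exists, $a_I$ is not identically zero on any $V_j\supset S$, all the orders below are finite, and $$\mathrm{GSV}(\omega,V,S)=\mathrm{ord}_S(a_I|_V)-\mathrm{ord}_S(\Delta_I|_V).$$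 In particular the index does not depend on the local equation or on the decomposition used to define it. -/

import Mathlib

open Filter Topology

noncomputable section

namespace Pfaff

/-- The local ring `𝒪_x` of germs at `x ∈ ℂⁿ` of holomorphic functions. -/
def HolGerm {n : ℕ} (x : Fin n → ℂ) : Subring (Germ (𝓝 x) ℂ) where
  carrier := {φ | ∃ h : (Fin n → ℂ) → ℂ, AnalyticAt ℂ h x ∧ φ = (h : Germ (𝓝 x) ℂ)}
  mul_mem' := by
    rintro _ _ ⟨h₁, a₁, rfl⟩ ⟨h₂, a₂, rfl⟩
    exact ⟨h₁ * h₂, a₁.mul a₂, rfl⟩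
  one_mem' := ⟨fun _ => 1, analyticAt_const, rfl⟩
  add_mem' := by
    rintro _ _ ⟨h₁, a₁, rfl⟩ ⟨h₂, a₂, rfl⟩
    exact ⟨h₁ + h₂, a₁.add a₂, rfl⟩
  zero_mem' := ⟨fun _ => 0, analyticAt_const, rfl⟩
  neg_mem' := by
    rintro _ ⟨h₁, a₁, rfl⟩
    exact ⟨-h₁, a₁.neg, rfl⟩

/-- The germ at `x` of a function `h` that is holomorphic at `x`. -/
def germ {n : ℕ} {x : Fin n → ℂ} (h : (Fin n → ℂ) → ℂ) (hh : AnalyticAt ℂ h x) : HolGerm x :=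
  ⟨(h : Germ (𝓝 x) ℂ), h, hh, rfl⟩

/-- The ideal of all holomorphic germs at `x` that vanish on the germ of the set `A` at `x`. -/
def vanishingIdeal {n : ℕ} (x : Fin n → ℂ) (A : Set (Fin n → ℂ)) : Ideal (HolGerm x) where
  carrier := {φ | ∃ h : (Fin n → ℂ) → ℂ, (φ : Germ (𝓝 x) ℂ) = (h : Germ (𝓝 x) ℂ) ∧
    ∀ᶠ z in 𝓝 x, z ∈ A → h z = 0}
  add_mem' := by
    rintro φ ψ ⟨h₁, e₁, v₁⟩ ⟨h₂, e₂, v₂⟩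
    refine ⟨h₁ + h₂, by rw [Subring.coe_add, e₁, e₂]; rfl, ?_⟩
    filter_upwards [v₁, v₂] with z w₁ w₂ hz
    simp [w₁ hz, w₂ hz]
  zero_mem' := ⟨fun _ => 0, rfl, Eventually.of_forall fun _ _ => rfl⟩
  smul_mem' := by
    rintro ⟨_, h₁, a₁, rfl⟩ ψ ⟨h₂, e₂, v₂⟩
    refine ⟨h₁ * h₂, by rw [smul_eq_mul, Subring.coe_mul, e₂]; rfl, ?_⟩
    filter_upwards [v₂] with z w₂ hz
    simp [w₂ hz]

/-- `f₁ = ⋯ = f_r = 0` is, near `x`, a local equation of the reduced variety `V`: it cuts out `V`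
as a set, and `f₁, …, f_r` generate the ideal of `V`. -/
def IsLocalEquation {n r : ℕ} (x : Fin n → ℂ) (V : Set (Fin n → ℂ))
    (f : Fin r → (Fin n → ℂ) → ℂ) (hf : ∀ i, AnalyticAt ℂ (f i) x) : Prop :=
  (∀ᶠ z in 𝓝 x, z ∈ V ↔ ∀ i, f i z = 0) ∧
    vanishingIdeal x V = Ideal.span (Set.range fun i => germ (f i) (hf i))

/-- The exterior product `ℓ₁ ∧ ⋯ ∧ ℓ_r` of linear forms,
`(ℓ₁ ∧ ⋯ ∧ ℓ_r)(v₁, …, v_r) = det (ℓ_j (v_i))`. -/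
def wedge {n r : ℕ} (ℓ : Fin r → ((Fin n → ℂ) →ₗ[ℂ] ℂ)) : (Fin n → ℂ) [⋀^Fin r]→ₗ[ℂ] ℂ :=
  (Matrix.detRowAlternating (n := Fin r) (R := ℂ)).compLinearMap (LinearMap.pi ℓ)

/-- `dZ_I = dz_{i₁} ∧ ⋯ ∧ dz_{i_r}` for a multi-index `I = (i₁ < ⋯ < i_r)`. -/
def dZ {n r : ℕ} (I : Fin r ↪o Fin n) : (Fin n → ℂ) [⋀^Fin r]→ₗ[ℂ] ℂ :=
  wedge fun j => LinearMap.proj (I j)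

/-- `df₁ ∧ ⋯ ∧ df_r` at the point `z`. -/
def wedgeD {n r : ℕ} (f : Fin r → (Fin n → ℂ) → ℂ) (z : Fin n → ℂ) :
    (Fin n → ℂ) [⋀^Fin r]→ₗ[ℂ] ℂ :=
  wedge fun j => (fderiv ℂ (f j) z : (Fin n → ℂ) →ₗ[ℂ] ℂ)

/-- The `r × r` minor `Δ_I` of the Jacobian matrix of `(f₁, …, f_r)` with columns `I`. -/
def jacMinor {n r : ℕ} (f : Fin r → (Fin n → ℂ) → ℂ) (I : Fin r ↪o Fin n) (z : Fin n → ℂ) : ℂ :=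
  (Matrix.of fun i j : Fin r => fderiv ℂ (f i) z (Pi.single (I j) 1)).det

theorem analyticAt_jacMinor {n r : ℕ} {x : Fin n → ℂ} {f : Fin r → (Fin n → ℂ) → ℂ}
    (hf : ∀ i, AnalyticAt ℂ (f i) x) (I : Fin r ↪o Fin n) : AnalyticAt ℂ (jacMinor f I) x := by
  unfold jacMinor
  simp only [Matrix.det_apply, Matrix.of_apply]
  refine Finset.analyticAt_fun_sum _ fun σ _ => ?_
  have : AnalyticAt ℂ (fun z => ∏ i, fderiv ℂ (f (σ i)) z (Pi.single (I i) (1 : ℂ))) x :=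
    Finset.analyticAt_fun_prod _ fun i _ =>
      ((ContinuousLinearMap.apply ℂ ℂ (Pi.single (I i) (1 : ℂ) : Fin n → ℂ)).analyticAt _).comp
        (hf (σ i)).fderiv
  rcases Int.units_eq_one_or (Equiv.Perm.sign σ) with h | h
  · simpa [h] using this
  · simpa [h, Pi.neg_def] using this.neg

/-- The irreducible components `V_j` of the germ of `V` at `x` that contain the germ of `S`, each
given by its prime ideal. -/
def componentsThrough {n : ℕ} (x : Fin n → ℂ) (V S : Set (Fin n → ℂ)) :
    Set (Ideal (HolGerm x)) :=
  {Q | Q ∈ (vanishingIdeal x V).minimalPrimes ∧ Q ≤ vanishingIdeal x S}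

/-- The order of vanishing of `h|_{V_j}` along `S`, where `V_j` and `S` are the irreducible germs
with prime ideals `Q ⊆ P`: the length of `A / hA`, where `A = 𝒪_{V_j, S}` is the localisation at
`P` of `𝒪_x / Q`. -/
def ordAlong {n : ℕ} {x : Fin n → ℂ} (P : Ideal (HolGerm x)) [P.IsPrime] (Q : Ideal (HolGerm x))
    (h : HolGerm x) : ℕ∞ :=
  Ring.ord (Localization.AtPrime P ⧸ Q.map (algebraMap (HolGerm x) (Localization.AtPrime P)))
    (Ideal.Quotient.mk _ (algebraMap (HolGerm x) (Localization.AtPrime P) h))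

/-- `ord_S (h|_V)`, the sum over the components `V_j` of `V` of the orders of `h|_{V_j}` along `S`;
it is meaningful when all of these are finite. -/
def ordOn {n : ℕ} (x : Fin n → ℂ) (V S : Set (Fin n → ℂ)) [(vanishingIdeal x S).IsPrime]
    (h : HolGerm x) : ℤ :=
  ∑ᶠ Q ∈ componentsThrough x V S, ((ordAlong (vanishingIdeal x S) Q h).toNat : ℤ)

/-- The decomposition `g ω = ξ df₁ ∧ ⋯ ∧ df_r + f₁ η₁ + ⋯ + f_r η_r` near `x`, with holomorphic
`r`-forms `η_i`. -/
def IsDecomposition {n r : ℕ} (x : Fin n → ℂ) (ω : (Fin n → ℂ) → (Fin n → ℂ) [⋀^Fin r]→ₗ[ℂ] ℂ)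
    (f : Fin r → (Fin n → ℂ) → ℂ) (g ξ : (Fin n → ℂ) → ℂ) : Prop :=
  ∃ η : Fin r → (Fin n → ℂ) → (Fin n → ℂ) [⋀^Fin r]→ₗ[ℂ] ℂ,
    (∀ i v, AnalyticAt ℂ (fun z => η i z v) x) ∧
    ∀ᶠ z in 𝓝 x, g z • ω z = ξ z • wedgeD f z + ∑ i, f i z • η i z

/-- `m` is the GSV index of `ω` relative to `V` in `S` (computed at `x`):
`m = ∑_j ord_S ((ξ / g)|_{V_j})` for a local equation `f` of `V` and a decomposition
`g ω = ξ df₁ ∧ ⋯ ∧ df_r + ∑ f_i η_i` with `g` not identically zero on the components `V_j`. Only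
the components `V_j` containing `S` contribute (they are all the components of `V` near a general
point of `S`), and only they are considered. -/
def IsGSVIndex {n r : ℕ} (x : Fin n → ℂ) (ω : (Fin n → ℂ) → (Fin n → ℂ) [⋀^Fin r]→ₗ[ℂ] ℂ)
    (V S : Set (Fin n → ℂ)) [(vanishingIdeal x S).IsPrime] (m : ℤ) : Prop :=
  ∃ (f : Fin r → (Fin n → ℂ) → ℂ) (hf : ∀ i, AnalyticAt ℂ (f i) x)
    (g ξ : (Fin n → ℂ) → ℂ) (hg : AnalyticAt ℂ g x) (hξ : AnalyticAt ℂ ξ x),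
    IsLocalEquation x V f hf ∧ IsDecomposition x ω f g ξ ∧
    (∀ Q ∈ componentsThrough x V S, germ g hg ∉ Q) ∧
    m = ∑ᶠ Q ∈ componentsThrough x V S,
      (((ordAlong (vanishingIdeal x S) Q (germ ξ hξ)).toNat : ℤ) -
        ((ordAlong (vanishingIdeal x S) Q (germ g hg)).toNat : ℤ))

/-- `V = {f = 0}` is an integral variety of the Pfaff system `ω` near `x`: `ι_v ω = 0` for every
vector `v` tangent to `V` at a point where `df₁, …, df_r` are linearly independent. For a
reduced complete intersection this is the same as the vanishing of `df_j ∧ ω` at the points of `V`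
for all `j`. For `r = 1` it says that the restriction of
`ω` to the regular part of `V` is zero. -/
def IsInvariant {n r : ℕ} (x : Fin n → ℂ) (ω : (Fin n → ℂ) → (Fin n → ℂ) [⋀^Fin r]→ₗ[ℂ] ℂ)
    (V : Set (Fin n → ℂ)) (f : Fin r → (Fin n → ℂ) → ℂ) : Prop :=
  ∀ᶠ z in 𝓝 x, z ∈ V → wedgeD f z ≠ 0 →
    ∀ v : Fin r → (Fin n → ℂ), (∃ i, ∀ j, fderiv ℂ (f j) z (v i) = 0) → ω z v = 0

/-- The germ of `S` at `x` is an irreducible component of the germ at `x` of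
`Sing(ω) ∩ V = {f₁ = ⋯ = f_r = 0, a_I = 0 for all I}`: its ideal is a minimal prime over the ideal
generated by these equations. -/
def IsSingComponent {n r : ℕ} (x : Fin n → ℂ) (f : Fin r → (Fin n → ℂ) → ℂ)
    (hf : ∀ i, AnalyticAt ℂ (f i) x) (a : (Fin r ↪o Fin n) → (Fin n → ℂ) → ℂ)
    (ha : ∀ I, AnalyticAt ℂ (a I) x) (S : Set (Fin n → ℂ)) : Prop :=
  vanishingIdeal x S ∈
    (Ideal.span (Set.range fun i => germ (f i) (hf i)) ⊔
      Ideal.span (Set.range fun I => germ (a I) (ha I))).minimalPrimes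

/-- The germ of `S` has codimension one in the germ of `V`. -/
def IsCodimOne {n : ℕ} (x : Fin n → ℂ) (V S : Set (Fin n → ℂ)) : Prop :=
  ((vanishingIdeal x S).map (Ideal.Quotient.mk (vanishingIdeal x V))).height = 1

end Pfaff

end

/-! Write r = n - k. At points of V the terms `f' i • η i` of a decomposition vanish, so comparing
coefficients gives g a_J = ξ Δ'_J on V for every J, where Δ'_J are the minors of the equations f'
used in the decomposition. The equations f' and f are related by a holomorphic matrix; on V its
determinant multiplies the minors, and it is a unit (`exists_isUnit_jacMinor`). Hence g a_I ≡ ξ u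
Δ_I modulo the ideal of each component through S, with u a unit. Orders along S are additive, so ord
ξ - ord g = ord a_I - ord Δ_I on each component, and the formula follows by summation.

The coefficient a_I cannot vanish on a component V_j ⊇ S: otherwise ξ would vanish there, then every
a_J, so V_j would lie in Sing(ω) ∩ V. As S is a component of that set, S would equal V_j, against
codimension one.

For existence, invariance makes ω proportional to df₁ ∧ ⋯ ∧ df_r where the latter is nonzero on V.
So Δ_I a_J - a_I Δ_J vanishes on V and is a combination of the f_i, which is a decomposition with g
= Δ_I and ξ = a_I.

Subtracting orders as integers requires finiteness, which holds because 𝒪_{V_j,S} is a Noetherian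
domain of dimension at most one. The dimension comes from the codimension hypothesis. Noetherianity
is Rückert's theorem, deduced by induction on the dimension from Weierstrass division, itself
obtained by inverting an operator on the disc algebra. -/

noncomputable section

namespace Pfaff

/-! ### The disc algebra and its backward shift -/

open Metric
open scoped NNReal ENNReal

/-- A linear equation whose operator and right-hand side depend holomorphically on a parameter has
a holomorphic solution near each point where the operator is invertible. -/
theorem exists_analyticAt_apply_eq {H W : Type*} [NormedAddCommGroup H] [NormedSpace ℂ H]
    [NormedAddCommGroup W] [NormedSpace ℂ W] [CompleteSpace W] {T : H → W →L[ℂ] W} {b : H → W}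
    {z₀ : H} (hT : AnalyticAt ℂ T z₀) (h : IsUnit (T z₀)) (hb : AnalyticAt ℂ b z₀) :
    ∃ Q : H → W, AnalyticAt ℂ Q z₀ ∧ ∀ᶠ z in 𝓝 z₀, T z (Q z) = b z := by
  have hI : AnalyticAt ℂ (fun z => Ring.inverse (T z)) z₀ := by
    refine AnalyticAt.fun_comp ?_ hT
    obtain ⟨u, hu⟩ := h
    rw [← hu]
    exact analyticAt_inverse u
  have hu : ∀ᶠ z in 𝓝 z₀, IsUnit (T z) :=
    hT.continuousAt.eventually (Units.isOpen.mem_nhds h)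
  refine ⟨fun z => Ring.inverse (T z) (b z),
    ((ContinuousLinearMap.id ℂ (W →L[ℂ] W)).analyticAt_bilinear _).comp₂ hI hb, ?_⟩
  filter_upwards [hu] with z hz
  rw [← mul_apply_eq_comp, Ring.mul_inverse_cancel _ hz]
  rfl

/-- The disc algebra: continuous functions on the closed disc of radius `ρ` that are holomorphic in
its interior. -/
def discAlgebra (ρ : ℝ) : Subalgebra ℂ C(closedBall (0 : ℂ) ρ, ℂ) where
  carrier := {F | ∃ φ : ℂ → ℂ, DifferentiableOn ℂ φ (ball 0 ρ) ∧ ∀ w, F w = φ w}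
  mul_mem' := by
    rintro F G ⟨φ, hφ, eF⟩ ⟨ψ, hψ, eG⟩
    exact ⟨φ * ψ, hφ.mul hψ, fun w => by simp [eF, eG]⟩
  add_mem' := by
    rintro F G ⟨φ, hφ, eF⟩ ⟨ψ, hψ, eG⟩
    exact ⟨φ + ψ, hφ.add hψ, fun w => by simp [eF, eG]⟩
  algebraMap_mem' c := ⟨fun _ => c, differentiableOn_const c, fun _ => rfl⟩

namespace discAlgebra

variable {ρ : ℝ}

theorem isClosed : IsClosed (discAlgebra ρ : Set C(closedBall (0 : ℂ) ρ, ℂ)) := by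
  refine IsSeqClosed.isClosed fun F G hF hG => ?_
  choose φ hφ eφ using hF
  classical
  -- The limit is extended by zero outside the closed disc; it is holomorphic inside as a uniform
  -- limit of holomorphic functions.
  refine ⟨fun w => if h : w ∈ closedBall (0 : ℂ) ρ then G ⟨w, h⟩ else 0, ?_, fun w => ?_⟩
  · refine TendstoLocallyUniformlyOn.differentiableOn (F := φ) (φ := atTop)
      (TendstoUniformlyOn.tendstoLocallyUniformlyOn ?_) (Eventually.of_forall hφ) isOpen_ball
    rw [ContinuousMap.tendsto_iff_tendstoUniformly] at hG
    intro u hu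
    filter_upwards [hG u hu] with k hk w hw
    have hw' := ball_subset_closedBall hw
    simpa [hw', ← eφ k ⟨w, hw'⟩] using hk ⟨w, hw'⟩
  · simp

/-- The disc algebra is a Banach space. -/
instance : CompleteSpace (discAlgebra ρ) :=
  isClosed.completeSpace_coe

/-- The element of the disc algebra given by a function on the plane. -/
def ofFun (φ : ℂ → ℂ) (hc : ContinuousOn φ (closedBall 0 ρ))
    (hd : DifferentiableOn ℂ φ (ball 0 ρ)) : discAlgebra ρ :=
  ⟨⟨fun w => φ w, hc.domRestrict⟩, φ, hd, fun _ => rfl⟩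

@[simp] theorem ofFun_apply (φ : ℂ → ℂ) (hc : ContinuousOn φ (closedBall 0 ρ))
    (hd : DifferentiableOn ℂ φ (ball 0 ρ)) (w : closedBall (0 : ℂ) ρ) :
    (ofFun φ hc hd).1 w = φ w := rfl

theorem norm_le {F : discAlgebra ρ} {C : ℝ} (hC : 0 ≤ C) (h : ∀ w, ‖F.1 w‖ ≤ C) : ‖F‖ ≤ C :=
  (ContinuousMap.norm_le F.1 hC).2 h

/-- Evaluation at a point of the disc. -/
def eval (w : closedBall (0 : ℂ) ρ) : discAlgebra ρ →L[ℂ] ℂ :=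
  (ContinuousMap.evalCLM ℂ w).comp (discAlgebra ρ).toSubmodule.subtypeL

@[simp] theorem eval_apply (w : closedBall (0 : ℂ) ρ) (F : discAlgebra ρ) : eval w F = F.1 w := rfl

/-- The coordinate function. -/
def coord (ρ : ℝ) : discAlgebra ρ := ofFun id continuousOn_id differentiableOn_id

@[simp] theorem coord_apply (w : closedBall (0 : ℂ) ρ) : (coord ρ).1 w = w := rfl

theorem ext {F G : discAlgebra ρ} (h : ∀ w, F.1 w = G.1 w) : F = G :=
  Subtype.ext (ContinuousMap.ext h)

theorem eq_zero_of_coord_mul (hρ : 0 < ρ) {F : discAlgebra ρ} (h : coord ρ * F = 0) : F = 0 := by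
  have h0 : ∀ w : closedBall (0 : ℂ) ρ, (w : ℂ) ≠ 0 → F.1 w = 0 := by
    intro w hw
    have := congrArg (fun G : discAlgebra ρ => G.1 w) h
    simpa [hw] using this
  obtain ⟨φ, hφ, eφ⟩ := F.2
  refine ext fun w => ?_
  by_cases hw : (w : ℂ) = 0
  · have hc : ContinuousAt φ 0 := (hφ.differentiableAt (ball_mem_nhds _ hρ)).continuousAt
    have h1 : Tendsto φ (𝓝[≠] 0) (𝓝 (φ 0)) := hc.tendsto.mono_left nhdsWithin_le_nhds
    have h2 : Tendsto φ (𝓝[≠] 0) (𝓝 0) := by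
      refine tendsto_const_nhds.congr' ?_
      filter_upwards [nhdsWithin_le_nhds (closedBall_mem_nhds (0 : ℂ) hρ), self_mem_nhdsWithin]
        with z hz hz0
      rw [← eφ ⟨z, hz⟩, h0 ⟨z, hz⟩ hz0]
    rw [eφ, hw, tendsto_nhds_unique h1 h2]
    rfl
  · exact h0 w hw

theorem exists_eq_add_coord_mul (hρ : 0 < ρ) (F : discAlgebra ρ) :
    ∃ (c : ℂ) (Q : discAlgebra ρ), F = algebraMap ℂ _ c + coord ρ * Q := by
  classical
  obtain ⟨φ, hφ, eφ⟩ := F.2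
  have hφc : ContinuousOn φ (closedBall 0 ρ) := by
    rw [continuousOn_iff_continuous_domRestrict]
    exact F.1.continuous.congr fun w => eφ w
  have hn := closedBall_mem_nhds (0 : ℂ) hρ
  have hd : DifferentiableAt ℂ φ 0 := hφ.differentiableAt (ball_mem_nhds _ hρ)
  -- `dslope φ 0` is (φ w - φ 0) / w with its singularity at the origin removed.
  refine ⟨φ 0, ofFun (dslope φ 0) ((continuousOn_dslope hn).2 ⟨hφc, hd⟩)
    ((Complex.differentiableOn_dslope (ball_mem_nhds _ hρ)).2 hφ), ext fun w => ?_⟩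
  have := sub_smul_dslope φ 0 (w : ℂ)
  simp only [sub_zero, smul_eq_mul] at this
  change F.1 w = φ 0 + w * dslope φ 0 w
  rw [this, eφ]; ring

/-- The decomposition of a function into its value at the origin and the rest. -/
def consEquiv (hρ : 0 < ρ) : (ℂ × discAlgebra ρ) ≃L[ℂ] discAlgebra ρ :=
  -- The open mapping theorem makes the inverse continuous, and with it `shift`.
  ContinuousLinearEquiv.ofBijective
    ((Algebra.linearMap ℂ (discAlgebra ρ)).toContinuousLinearMap.coprod
      (ContinuousLinearMap.mul ℂ (discAlgebra ρ) (coord ρ)))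
    (by
      rw [LinearMap.ker_eq_bot']
      rintro ⟨c, Q⟩ h
      have h : algebraMap ℂ _ c + coord ρ * Q = 0 := h
      have hc : c = 0 := by
        have := congrArg (fun G : discAlgebra ρ => G.1 ⟨0, by simp [hρ.le]⟩) h
        simpa using this
      subst hc
      rw [map_zero, zero_add] at h
      rw [eq_zero_of_coord_mul hρ h]
      rfl)
    (by
      rw [LinearMap.range_eq_top]
      intro F
      obtain ⟨c, Q, h⟩ := exists_eq_add_coord_mul hρ F
      exact ⟨(c, Q), h.symm⟩)

/-- The backward shift `F ↦ (F - F(0)) / w`. -/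
def shift (hρ : 0 < ρ) : discAlgebra ρ →L[ℂ] discAlgebra ρ :=
  (ContinuousLinearMap.snd ℂ ℂ _).comp ((consEquiv hρ).symm : discAlgebra ρ →L[ℂ] _)

theorem shift_coord_mul (hρ : 0 < ρ) (Q : discAlgebra ρ) : shift hρ (coord ρ * Q) = Q := by
  have : coord ρ * Q = consEquiv hρ (0, Q) := by
    change _ = algebraMap ℂ _ 0 + coord ρ * Q
    simp
  rw [this]
  simp [shift]

theorem eq_add_coord_mul_shift (hρ : 0 < ρ) (F : discAlgebra ρ) :
    F = algebraMap ℂ _ (F.1 ⟨0, by simp [hρ.le]⟩) + coord ρ * shift hρ F := by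
  obtain ⟨c, Q, h⟩ := exists_eq_add_coord_mul hρ F
  have hc : F.1 ⟨0, by simp [hρ.le]⟩ = c := by rw [h]; simp
  have hQ : shift hρ F = Q := by
    have : F = consEquiv hρ (c, Q) := h
    rw [this]
    simp [shift]
  rw [hc, hQ, ← h]

/-- Taylor expansion with remainder; it shows that an element killed by `shift ^ d` is a polynomial
of degree less than d. -/
theorem eq_sum_add_coord_pow_mul_shift (hρ : 0 < ρ) (F : discAlgebra ρ) (d : ℕ) :
    F = ∑ k ∈ Finset.range d, algebraMap ℂ _ (((shift hρ ^ k) F).1 ⟨0, by simp [hρ.le]⟩) *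
      coord ρ ^ k + coord ρ ^ d * (shift hρ ^ d) F := by
  induction d with
  | zero => simp
  | succ d ih =>
    rw [Finset.sum_range_succ]
    nth_rewrite 1 [ih]
    rw [add_assoc]
    congr 1
    nth_rewrite 1 [eq_add_coord_mul_shift hρ ((shift hρ ^ d) F)]
    rw [pow_succ' (shift hρ) d, mul_apply_eq_comp]
    ring

theorem shift_pow_coord_pow_mul (hρ : 0 < ρ) (Q : discAlgebra ρ) (d : ℕ) :
    (shift hρ ^ d) (coord ρ ^ d * Q) = Q := by
  induction d with
  | zero => simp
  | succ d ih =>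
    rw [pow_succ (shift hρ), mul_apply_eq_comp, pow_succ', mul_assoc, shift_coord_mul,
      ih]

theorem isUnit_of_forall_ne_zero {F : discAlgebra ρ} (h : ∀ w, F.1 w ≠ 0) : IsUnit F := by
  obtain ⟨φ, hφ, eφ⟩ := F.2
  have hc : ContinuousOn φ (closedBall 0 ρ) := by
    rw [continuousOn_iff_continuous_domRestrict]
    exact F.1.continuous.congr fun w => eφ w
  have h0 : ∀ w ∈ closedBall (0 : ℂ) ρ, φ w ≠ 0 := fun w hw => eφ ⟨w, hw⟩ ▸ h ⟨w, hw⟩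
  refine IsUnit.of_mul_eq_one (ofFun (fun w => (φ w)⁻¹) (hc.inv₀ h0)
    (hφ.inv fun w hw => h0 w (ball_subset_closedBall hw))) (ext fun w => ?_)
  change F.1 w * (φ w)⁻¹ = 1
  rw [eφ, mul_inv_cancel₀ (h0 w w.2)]

/-- A holomorphic family of elements of the disc algebra is a holomorphic function of all
variables. -/
theorem exists_analyticAt_uncurry {H : Type*} [NormedAddCommGroup H] [NormedSpace ℂ H]
    (hρ : 0 < ρ) {G : H → discAlgebra ρ} (hG : AnalyticAt ℂ G 0) :
    ∃ q : H × ℂ → ℂ, AnalyticAt ℂ q 0 ∧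
      ∀ᶠ p in 𝓝 (0 : H × ℂ), ∀ h : p.2 ∈ closedBall (0 : ℂ) ρ, q p = (G p.1).1 ⟨p.2, h⟩ := by
  have hG' : AnalyticAt ℂ (fun p : H × ℂ => G p.1) 0 :=
    AnalyticAt.fun_comp (g := G) (f := Prod.fst) hG analyticAt_fst
  -- Evaluation at a varying point w is traded for evaluation at 0. If Q - w • shift Q = G, then
  -- G(w) = Q(w) - w (shift Q)(w) = Q(0), and Q depends holomorphically on w as well.
  obtain ⟨Q, hQ, hQe⟩ := exists_analyticAt_apply_eq
    (T := fun p : H × ℂ => ContinuousLinearMap.id ℂ (discAlgebra ρ) - p.2 • shift hρ)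
    (analyticAt_const.sub (analyticAt_snd.smul analyticAt_const))
    (by
      convert isUnit_one using 1
      ext1 F
      change F - (0 : ℂ) • _ = F
      rw [zero_smul, sub_zero]) hG'
  refine ⟨fun p => eval ⟨0, by simp [hρ.le]⟩ (Q p),
    (ContinuousLinearMap.analyticAt _ _).fun_comp hQ, ?_⟩
  filter_upwards [hQe] with p hp h
  have h1 := congrArg (fun G : discAlgebra ρ => G.1 ⟨p.2, h⟩) (eq_add_coord_mul_shift hρ (Q p))
  have h2 := congrArg (fun G : discAlgebra ρ => G.1 ⟨p.2, h⟩) hp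
  change (Q p).1 ⟨p.2, h⟩ = (Q p).1 ⟨0, _⟩ + p.2 * (shift hρ (Q p)).1 ⟨p.2, h⟩ at h1
  change (Q p).1 ⟨p.2, h⟩ - p.2 * (shift hρ (Q p)).1 ⟨p.2, h⟩ = _ at h2
  rw [← h2, h1]
  simp

end discAlgebra

/-! ### Currying: from functions on H × ℂ to families in the disc algebra -/

namespace discAlgebra

variable {H : Type*} [NormedAddCommGroup H] [NormedSpace ℂ H]

/-- The bounds `B m` must be uniform in the centre y, so that they control coefficients in the sup
norm of the disc algebra. -/
theorem exists_summable_nnnorm_changeOrigin {E F : Type*} [NormedAddCommGroup E] [NormedSpace ℂ E]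
    [NormedAddCommGroup F] [NormedSpace ℂ F] (p : FormalMultilinearSeries ℂ E F) {r r' : ℝ≥0}
    (h : (r + r' : ℝ≥0∞) < p.radius) :
    ∃ B : ℕ → ℝ≥0, (Summable fun m => B m * r ^ m) ∧
      ∀ y : E, ‖y‖₊ ≤ r' → ∀ m, ‖p.changeOrigin y m‖₊ ≤ B m := by
  have hr' : (r' : ℝ≥0∞) < p.radius := lt_of_le_of_lt le_add_self h
  refine ⟨fun m => ∑' s : Σ l : ℕ, { s : Finset (Fin (m + l)) // s.card = l },
    ‖p (m + s.1)‖₊ * r' ^ s.1, ?_, fun y hy m => ?_⟩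
  · simpa only [← NNReal.tsum_mul_right] using
      (NNReal.summable_sigma.1 (p.changeOriginSeries_summable_aux₁ (add_comm (r : ℝ≥0∞) r' ▸ h))).2
  · refine (p.nnnorm_changeOrigin_le m (lt_of_le_of_lt (by exact_mod_cast hy) hr')).trans ?_
    refine Summable.tsum_le_tsum (fun s => by gcongr) ?_ (p.changeOriginSeries_summable_aux₂ hr' m)
    refine NNReal.summable_of_le (fun s => ?_) (p.changeOriginSeries_summable_aux₂ hr' m)
    gcongr

/-- The coefficient of degree `m`, in the first variable, of the power series `p` in two variables,
as a function of the second variable in a disc. -/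
def coeff (p : FormalMultilinearSeries ℂ (H × ℂ) ℂ) {ρ : ℝ≥0} (hρ : (ρ : ℝ≥0∞) < p.radius) (m : ℕ)
    (B : ℝ≥0) (hB : ∀ w : ℂ, ‖w‖₊ ≤ ρ → ‖p.changeOrigin ((0 : H), w) m‖₊ ≤ B) :
    ContinuousMultilinearMap ℂ (fun _ : Fin m => H) (discAlgebra ρ) :=
  have han : ∀ v : Fin m → H, AnalyticOnNhd ℂ
      (fun w : ℂ => p.changeOrigin ((0 : H), w) m fun j => (v j, 0)) (closedBall 0 ρ) := by
    intro v w hw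
    have h1 : AnalyticAt ℂ (fun y => p.changeOrigin y m) ((0 : H), w) := by
      refine (p.hasFPowerSeriesOnBall_changeOrigin m (pos_of_gt hρ)).analyticAt_of_mem ?_
      rw [mem_eball_zero_iff]
      refine lt_of_le_of_lt ?_ hρ
      have : ‖((0 : H), w)‖₊ ≤ ρ := by
        rw [mem_closedBall_zero_iff] at hw
        simpa [Prod.nnnorm_def, ← NNReal.coe_le_coe] using hw
      exact_mod_cast this
    have h2 : AnalyticAt ℂ (fun w : ℂ => p.changeOrigin ((0 : H), w) m) w :=
      h1.fun_comp (analyticAt_const.prod analyticAt_id)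
    exact ((ContinuousMultilinearMap.apply ℂ (fun _ : Fin m => H × ℂ) ℂ
      fun j => (v j, 0)).analyticAt _).fun_comp h2
  MultilinearMap.mkContinuous
    { toFun := fun v => ofFun (fun w : ℂ => p.changeOrigin ((0 : H), w) m fun j => (v j, 0))
        (han v).continuousOn ((han v).differentiableOn.mono ball_subset_closedBall)
      map_update_add' := by
        intro _ v i x y
        refine ext fun w => ?_
        exact ((p.changeOrigin ((0 : H), (w : ℂ)) m).compContinuousLinearMap
          fun _ => ContinuousLinearMap.inl ℂ H ℂ).map_update_add v i x y
      map_update_smul' := by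
        intro _ v i c x
        refine ext fun w => ?_
        exact ((p.changeOrigin ((0 : H), (w : ℂ)) m).compContinuousLinearMap
          fun _ => ContinuousLinearMap.inl ℂ H ℂ).map_update_smul v i c x }
    B fun v => by
      refine norm_le (by positivity) fun w => ?_
      change ‖p.changeOrigin ((0 : H), (w : ℂ)) m fun j => (v j, 0)‖ ≤ _
      refine (ContinuousMultilinearMap.le_opNorm _ _).trans ?_
      have h1 := hB w (mem_closedBall_zero_iff.1 w.2)
      have h2 : ∀ j, ‖((v j, 0) : H × ℂ)‖ = ‖v j‖ := fun j => by simp [Prod.norm_def]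
      simp only [h2]
      gcongr
      exact_mod_cast h1

theorem nnnorm_coeff_le (p : FormalMultilinearSeries ℂ (H × ℂ) ℂ) {ρ : ℝ≥0}
    (hρ : (ρ : ℝ≥0∞) < p.radius) (m : ℕ)
    (B : ℝ≥0) (hB : ∀ w : ℂ, ‖w‖₊ ≤ ρ → ‖p.changeOrigin ((0 : H), w) m‖₊ ≤ B) :
    ‖coeff p hρ m B hB‖₊ ≤ B := by
  unfold coeff
  exact MultilinearMap.mkContinuous_norm_le _ B.2 _

/-- A holomorphic function of two variables is a holomorphic family of elements of the disc
algebra. -/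
theorem exists_analyticAt_curry {g : H × ℂ → ℂ} (hg : AnalyticAt ℂ g 0) :
    ∃ ρ₀ : ℝ≥0, 0 < ρ₀ ∧ ∀ ρ : ℝ≥0, 0 < ρ → ρ ≤ ρ₀ → ∃ G : H → discAlgebra ρ, AnalyticAt ℂ G 0 ∧
      ∀ᶠ z in 𝓝 (0 : H), ∀ w, (G z).1 w = g (z, w) := by
  obtain ⟨p, R, hp⟩ := hg
  -- One ρ₀ is for moving the centre to (0, w), the other for the displacement (z, 0) from it.
  obtain ⟨ρ₀, h0, h2⟩ : ∃ ρ₀ : ℝ≥0, 0 < ρ₀ ∧ (ρ₀ + ρ₀ : ℝ≥0∞) < R := by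
    obtain ⟨s, hs0, hs⟩ := ENNReal.lt_iff_exists_nnreal_btwn.1 hp.r_pos
    refine ⟨s / 2, half_pos (by exact_mod_cast hs0), ?_⟩
    rw [← ENNReal.coe_add, add_halves]
    exact hs
  refine ⟨ρ₀, h0, fun ρ hρ hρ₀ => ?_⟩
  obtain ⟨B, hBs, hB⟩ := exists_summable_nnnorm_changeOrigin p (h2.trans_le hp.r_le)
  have hρR : (ρ : ℝ≥0∞) < R :=
    lt_of_le_of_lt (le_trans (by exact_mod_cast hρ₀) le_self_add) h2
  have hB' : ∀ m, ∀ w : ℂ, ‖w‖₊ ≤ ρ → ‖p.changeOrigin ((0 : H), w) m‖₊ ≤ B m := fun m w hw =>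
    hB _ (by simpa [Prod.nnnorm_def] using hw.trans hρ₀) m
  let P : FormalMultilinearSeries ℂ H (discAlgebra ρ) := fun m =>
    coeff p (hρR.trans_le hp.r_le) m (B m) (hB' m)
  have hPr : (ρ₀ : ℝ≥0∞) ≤ P.radius := by
    refine P.le_radius_of_summable_nnnorm (NNReal.summable_of_le (fun m => ?_) hBs)
    gcongr
    exact nnnorm_coeff_le _ _ _ _ _
  have hP := P.hasFPowerSeriesOnBall (lt_of_lt_of_le (by exact_mod_cast h0) hPr)
  refine ⟨P.sum, hP.analyticAt, ?_⟩
  filter_upwards [eball_mem_nhds (0 : H) (ENNReal.coe_pos.2 h0)] with z hz w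
  rw [mem_eball_zero_iff] at hz
  have h1 := hP.hasSum (y := z) (by rw [mem_eball_zero_iff]; exact hz.trans_le hPr)
  have h1' := (eval w).hasSum h1
  have hw : ‖((0 : H), (w : ℂ))‖₊ ≤ ρ := by
    have := mem_closedBall_zero_iff.1 w.2
    simpa [Prod.nnnorm_def, ← NNReal.coe_le_coe] using this
  have h3 := (hp.changeOrigin (y := ((0 : H), (w : ℂ)))
    (lt_of_le_of_lt (by exact_mod_cast hw) hρR)).hasSum (y := (z, 0)) (by
      rw [mem_eball_zero_iff]
      refine lt_tsub_iff_right.2 (lt_of_le_of_lt ?_ h2)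
      refine add_le_add ?_ (by exact_mod_cast hw.trans hρ₀)
      have : ‖(z, (0 : ℂ))‖ₑ = ‖z‖ₑ := by simp [enorm, Prod.nnnorm_def]
      rw [this]
      exact hz.le)
  simp only [zero_add, Prod.mk_add_mk, add_zero] at h3 h1'
  exact HasSum.unique h1' h3

end discAlgebra

/-! ### Weierstrass division -/

/-- Division by a holomorphic family `G` in a Banach algebra, with respect to a left inverse `D` of
the multiplication by `c`, when `G z₀` is `c` times a unit. -/
theorem exists_analyticAt_division {H A : Type*} [NormedAddCommGroup H] [NormedSpace ℂ H]
    [NormedCommRing A] [NormedAlgebra ℂ A] [CompleteSpace A] (D : A →L[ℂ] A) {c U : A}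
    (hD : ∀ X, D (c * X) = X) (hU : IsUnit U) {F G : H → A} {z₀ : H} (hF : AnalyticAt ℂ F z₀)
    (hG : AnalyticAt ℂ G z₀) (hG0 : G z₀ = c * U) :
    ∃ Q : H → A, AnalyticAt ℂ Q z₀ ∧ AnalyticAt ℂ (fun z => F z - G z * Q z) z₀ ∧
      ∀ᶠ z in 𝓝 z₀, D (F z - G z * Q z) = 0 := by
  -- `Λ (G z)` is X ↦ D (G z * X). At z₀ it is multiplication by U, hence invertible, so D (G z * Q
  -- z) = D (F z) has a holomorphic solution Q.
  let Λ : A →L[ℂ] A →L[ℂ] A :=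
    (ContinuousLinearMap.compL ℂ A A A D).comp (ContinuousLinearMap.mul ℂ A)
  have hΛ : ∀ X Y, Λ X Y = D (X * Y) := fun _ _ => rfl
  have hT : AnalyticAt ℂ (fun z => Λ (G z)) z₀ := (Λ.analyticAt _).fun_comp hG
  have hT0 : IsUnit (Λ (G z₀)) := by
    obtain ⟨U', rfl⟩ := hU
    have hT0 : ∀ X, Λ (G z₀) X = U' * X := by
      intro X
      rw [hΛ, hG0, mul_assoc, hD]
    refine ⟨⟨Λ (G z₀), ContinuousLinearMap.mul ℂ A (U'⁻¹ : Aˣ), ?_, ?_⟩, rfl⟩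
    · ext1 X
      change Λ (G z₀) ((U'⁻¹ : Aˣ) * X) = X
      rw [hT0, Units.mul_inv_cancel_left]
    · ext1 X
      change (U'⁻¹ : Aˣ) * Λ (G z₀) X = X
      rw [hT0, Units.inv_mul_cancel_left]
  obtain ⟨Q, hQ, hQe⟩ := exists_analyticAt_apply_eq hT hT0 ((D.analyticAt _).fun_comp hF)
  refine ⟨Q, hQ, hF.sub (hG.mul hQ), ?_⟩
  filter_upwards [hQe] with z hz
  rw [map_sub, ← hz, hΛ, sub_self]

/-- Weierstrass division by a function that is regular of order `d` in the last variable. -/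
theorem exists_weierstrass_division {H : Type*} [NormedAddCommGroup H] [NormedSpace ℂ H]
    {f g : H × ℂ → ℂ} (hf : AnalyticAt ℂ f 0) (hg : AnalyticAt ℂ g 0) {d : ℕ} {u : ℂ → ℂ}
    (hu : AnalyticAt ℂ u 0) (hu0 : u 0 ≠ 0) (hgu : ∀ᶠ w in 𝓝 (0 : ℂ), g (0, w) = w ^ d * u w) :
    ∃ (q : H × ℂ → ℂ) (r : ℕ → H → ℂ), AnalyticAt ℂ q 0 ∧ (∀ k, AnalyticAt ℂ (r k) 0) ∧
      ∀ᶠ p in 𝓝 (0 : H × ℂ), f p = q p * g p + ∑ k ∈ Finset.range d, r k p.1 * p.2 ^ k := by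
  obtain ⟨ρ₁, h1, hF⟩ := discAlgebra.exists_analyticAt_curry hf
  obtain ⟨ρ₂, h2, hG⟩ := discAlgebra.exists_analyticAt_curry hg
  obtain ⟨ε, hε, hball⟩ := Metric.eventually_nhds_iff_ball.1
    (hu.eventually_analyticAt.and ((hu.continuousAt.eventually_ne hu0).and hgu))
  -- On this disc both functions can be curried, and u is holomorphic without zeros, hence a unit of
  -- the disc algebra.
  obtain ⟨ρ, hρ, hρ₁, hρ₂, hρε⟩ : ∃ ρ : ℝ≥0, 0 < ρ ∧ ρ ≤ ρ₁ ∧ ρ ≤ ρ₂ ∧ (ρ : ℝ) < ε := by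
    refine ⟨min (min ρ₁ ρ₂) (ε.toNNReal / 2), ?_, ?_, ?_, ?_⟩
    · simp [h1, h2, hε]
    · exact (min_le_left _ _).trans (min_le_left _ _)
    · exact (min_le_left _ _).trans (min_le_right _ _)
    · refine lt_of_le_of_lt (NNReal.coe_le_coe.2 (min_le_right _ _)) ?_
      rw [NNReal.coe_div, Real.coe_toNNReal _ hε.le]
      exact half_lt_self hε
  obtain ⟨F, hFa, hFe⟩ := hF ρ hρ hρ₁
  obtain ⟨G, hGa, hGe⟩ := hG ρ hρ hρ₂
  have hρ' : (0 : ℝ) < ρ := hρ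
  have hsub : closedBall (0 : ℂ) ρ ⊆ ball 0 ε := closedBall_subset_ball hρε
  have hud : AnalyticOnNhd ℂ u (closedBall 0 ρ) := fun w hw => (hball w (hsub hw)).1
  let U : discAlgebra ρ := discAlgebra.ofFun u hud.continuousOn
    (hud.differentiableOn.mono ball_subset_closedBall)
  have hU : IsUnit U := discAlgebra.isUnit_of_forall_ne_zero fun w => (hball w (hsub w.2)).2.1
  have hG0 : G 0 = discAlgebra.coord ρ ^ d * U := by
    refine discAlgebra.ext fun w => ?_
    rw [hGe.self_of_nhds w, (hball w (hsub w.2)).2.2]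
    simp [U]
  obtain ⟨Q, hQ, hR, hQe⟩ := exists_analyticAt_division (discAlgebra.shift hρ' ^ d)
    (fun X => discAlgebra.shift_pow_coord_pow_mul hρ' X d) hU hFa hGa hG0
  obtain ⟨q, hq, hqe⟩ := discAlgebra.exists_analyticAt_uncurry hρ' hQ
  -- The r k are the Taylor coefficients in w of the remainder F - G Q, which `shift ^ d` kills.
  refine ⟨q, fun k z => discAlgebra.eval ⟨0, by simp⟩ ((discAlgebra.shift hρ' ^ k)
    (F z - G z * Q z)), hq, fun k => ((discAlgebra.eval _).analyticAt _).fun_comp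
      (((discAlgebra.shift hρ' ^ k).analyticAt _).fun_comp hR), ?_⟩
  have hfst : Tendsto (Prod.fst : H × ℂ → H) (𝓝 0) (𝓝 0) := continuous_fst.tendsto' _ _ rfl
  have hsnd : Tendsto (Prod.snd : H × ℂ → ℂ) (𝓝 0) (𝓝 0) := continuous_snd.tendsto' _ _ rfl
  filter_upwards [hqe, hfst.eventually hFe, hfst.eventually hGe, hfst.eventually hQe,
    hsnd.eventually (closedBall_mem_nhds _ hρ')] with p hp hFp hGp hQp hpρ
  have key := discAlgebra.eq_sum_add_coord_pow_mul_shift hρ' (F p.1 - G p.1 * Q p.1) d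
  rw [show (discAlgebra.shift hρ' ^ d) (F p.1 - G p.1 * Q p.1) = 0 from hQp, mul_zero,
    add_zero] at key
  have key' := congrArg (discAlgebra.eval ⟨p.2, hpρ⟩) key
  rw [map_sub, map_sum] at key'
  have e1 : discAlgebra.eval ⟨p.2, hpρ⟩ (F p.1) = f p := hFp ⟨p.2, hpρ⟩
  have e2 : discAlgebra.eval ⟨p.2, hpρ⟩ (G p.1 * Q p.1) = g p * q p := by
    rw [hp hpρ, ← show (G p.1).1 ⟨p.2, hpρ⟩ = g p from hGp ⟨p.2, hpρ⟩]
    rfl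
  rw [e1, e2, sub_eq_iff_eq_add] at key'
  rw [key', add_comm, mul_comm]
  rfl

/-! ### Noetherianity of the rings of germs -/

/-- Division makes A / (g) a finite R-module, generated by the classes of 1, w, …, w^(d-1). -/
theorem isNoetherianRing_quotient_of_division {R A : Type*} [CommRing R] [CommRing A]
    [IsNoetherianRing R] (φ : R →+* A) (g w : A) (d : ℕ)
    (h : ∀ f : A, ∃ (q : A) (r : ℕ → R), f = q * g + ∑ k ∈ Finset.range d, φ (r k) * w ^ k) :
    IsNoetherianRing (A ⧸ Ideal.span {g}) := by
  classical
  algebraize [φ]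
  have : Module.Finite R (A ⧸ Ideal.span {g}) := by
    refine ⟨⟨(Finset.range d).image fun k => Ideal.Quotient.mk _ (w ^ k), ?_⟩⟩
    rw [eq_top_iff]
    rintro y -
    obtain ⟨f, rfl⟩ := Ideal.Quotient.mk_surjective y
    obtain ⟨q, r, rfl⟩ := h f
    rw [map_add, map_sum, map_mul,
      Ideal.Quotient.eq_zero_iff_mem.2 (Ideal.mem_span_singleton_self g), mul_zero, zero_add]
    refine Submodule.sum_mem _ fun k hk => ?_
    have : Ideal.Quotient.mk (Ideal.span {g}) (φ (r k) * w ^ k) =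
        r k • Ideal.Quotient.mk (Ideal.span {g}) (w ^ k) := by
      rw [Algebra.smul_def, map_mul]
      rfl
    rw [this]
    exact Submodule.smul_mem _ _ (Submodule.subset_span (Finset.mem_image_of_mem _ hk))
  exact isNoetherian_of_tower R inferInstance

/-- A nonzero ideal J contains some g ≠ 0, and both (g) and J / (g) are finitely generated. -/
theorem isNoetherianRing_of_quotient {A : Type*} [CommRing A]
    (h : ∀ g : A, g ≠ 0 → IsNoetherianRing (A ⧸ Ideal.span {g})) : IsNoetherianRing A := by
  refine ⟨fun J => ?_⟩
  by_cases hJ : J = ⊥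
  · rw [hJ]
    exact Submodule.fg_bot
  obtain ⟨g, hg, hg0⟩ := Submodule.exists_mem_ne_zero_of_ne_bot hJ
  have := h g hg0
  have hmap : J.map (Submodule.mkQ (Ideal.span {g})) =
      (Ideal.map (Ideal.Quotient.mk (Ideal.span {g})) J).restrictScalars A := by
    ext y
    rw [Submodule.restrictScalars_mem,
      Ideal.mem_map_iff_of_surjective _ Ideal.Quotient.mk_surjective]
    rfl
  refine Submodule.fg_of_fg_map_of_fg_inf_ker (Submodule.mkQ (Ideal.span {g})) ?_ ?_
  · rw [hmap]
    exact (IsNoetherian.noetherian _).restrictScalars_of_surjective Ideal.Quotient.mk_surjective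
  rw [Submodule.ker_mkQ, inf_eq_right.2 ((Ideal.span_singleton_le_iff_mem J).2 hg)]
  exact ⟨{g}, by simp⟩

/-- The ring of germs at `x` of holomorphic functions on a normed space. -/
def analyticGerms {E : Type*} [NormedAddCommGroup E] [NormedSpace ℂ E] (x : E) :
    Subring (Germ (𝓝 x) ℂ) where
  carrier := {φ | ∃ h : E → ℂ, AnalyticAt ℂ h x ∧ φ = (h : Germ (𝓝 x) ℂ)}
  mul_mem' := by
    rintro _ _ ⟨h₁, a₁, rfl⟩ ⟨h₂, a₂, rfl⟩
    exact ⟨h₁ * h₂, a₁.mul a₂, rfl⟩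
  one_mem' := ⟨fun _ => 1, analyticAt_const, rfl⟩
  add_mem' := by
    rintro _ _ ⟨h₁, a₁, rfl⟩ ⟨h₂, a₂, rfl⟩
    exact ⟨h₁ + h₂, a₁.add a₂, rfl⟩
  zero_mem' := ⟨fun _ => 0, analyticAt_const, rfl⟩
  neg_mem' := by
    rintro _ ⟨h₁, a₁, rfl⟩
    exact ⟨-h₁, a₁.neg, rfl⟩

namespace analyticGerms

variable {E : Type*} [NormedAddCommGroup E] [NormedSpace ℂ E] {x : E}

theorem isUnit_of_ne_zero {g : E → ℂ} (hg : AnalyticAt ℂ g x) (h : g x ≠ 0) :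
    IsUnit (⟨(g : Germ (𝓝 x) ℂ), g, hg, rfl⟩ : analyticGerms x) := by
  refine IsUnit.of_mul_eq_one
    (⟨((fun y => (g y)⁻¹ : E → ℂ) : Germ (𝓝 x) ℂ), _, hg.fun_inv h, rfl⟩ : analyticGerms x)
    (Subtype.ext (Germ.coe_eq.2 ?_))
  filter_upwards [hg.continuousAt.eventually_ne h] with y hy
  exact mul_inv_cancel₀ hy

/-- The pull-back of germs along a holomorphic map. -/
def comap {E' : Type*} [NormedAddCommGroup E'] [NormedSpace ℂ E'] {y : E'} (π : E' → E)
    (hπ : AnalyticAt ℂ π y) (hy : π y = x) : analyticGerms x →+* analyticGerms y where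
  toFun φ := ⟨(φ : Germ (𝓝 x) ℂ).compTendsto π (hy ▸ hπ.continuousAt), by
    obtain ⟨_, h, hh, rfl⟩ := φ
    exact ⟨h ∘ π, AnalyticAt.comp (by rwa [hy]) hπ, rfl⟩⟩
  map_one' := rfl
  map_mul' := by
    rintro ⟨_, h, hh, rfl⟩ ⟨_, h', hh', rfl⟩
    rfl
  map_zero' := rfl
  map_add' := by
    rintro ⟨_, h, hh, rfl⟩ ⟨_, h', hh', rfl⟩
    rfl

/-- A holomorphic function with non-zero germ at `x` does not vanish on some line through `x`. -/
theorem exists_line_not_eventually_eq_zero {g : E → ℂ} (hg : AnalyticAt ℂ g x)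
    (h : ¬ ∀ᶠ y in 𝓝 x, g y = 0) : ∃ v : E, ¬ ∀ᶠ t in 𝓝 (0 : ℂ), g (x + t • v) = 0 := by
  by_contra! hv
  apply h
  obtain ⟨ε, hε, hball⟩ := hg.exists_ball_analyticOnNhd
  filter_upwards [Metric.ball_mem_nhds x hε] with y hy
  have hy' : ‖y - x‖ < ε := by rwa [← dist_eq_norm]
  let s : Set ℂ := {t | ‖t • (y - x)‖ < ε}
  have hs : Convex ℝ s := by
    intro a ha b hb α β hα hβ hαβ
    have ha' : a • (y - x) ∈ Metric.ball (0 : E) ε := mem_ball_zero_iff.2 ha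
    have hb' : b • (y - x) ∈ Metric.ball (0 : E) ε := mem_ball_zero_iff.2 hb
    have := convex_ball (0 : E) ε ha' hb' hα hβ hαβ
    rw [mem_ball_zero_iff] at this
    simpa only [s, Set.mem_ofPred_eq, add_smul, smul_assoc] using this
  -- The identity theorem on the convex set s carries the vanishing from t near 0 to t = 1, that is,
  -- to y.
  have han : AnalyticOnNhd ℂ (fun t : ℂ => g (x + t • (y - x))) s := by
    intro t ht
    refine AnalyticAt.fun_comp (hball _ ?_)
      (analyticAt_const.add (analyticAt_id.smul analyticAt_const))
    simpa [dist_eq_norm, s] using ht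
  have := han.eqOn_zero_of_preconnected_of_eventuallyEq_zero hs.isPreconnected
    (z₀ := 0) (by simpa [s] using hε) (hv (y - x))
  simpa using this (show (1 : ℂ) ∈ s by simpa [s] using hy')

theorem isNoetherianRing_of_finrank_eq (d : ℕ) : ∀ (E : Type*) [NormedAddCommGroup E]
    [NormedSpace ℂ E] [FiniteDimensional ℂ E] (x : E), Module.finrank ℂ E = d →
    IsNoetherianRing (analyticGerms x) := by
  induction d using Nat.strong_induction_on with
  | _ d ih =>
  intro E _ _ _ x hd
  refine isNoetherianRing_of_quotient ?_
  rintro ⟨_, g, hg, rfl⟩ hg0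
  by_cases hgx : g x = 0
  swap
  · have : Subsingleton (analyticGerms x ⧸ Ideal.span
        {(⟨(g : Germ (𝓝 x) ℂ), g, hg, rfl⟩ : analyticGerms x)}) := by
      rw [Ideal.Quotient.subsingleton_iff, Ideal.span_singleton_eq_top]
      exact isUnit_of_ne_zero hg hgx
    infer_instance
  have hg1 : ¬ ∀ᶠ y in 𝓝 x, g y = 0 := fun h => hg0 (Subtype.ext (Germ.coe_eq.2 h))
  obtain ⟨v, hv⟩ := exists_line_not_eventually_eq_zero hg hg1
  have hv0 : v ≠ 0 := by
    rintro rfl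
    simp [hgx] at hv
  -- In the coordinates E = H ⊕ ℂ v, g is regular in the last variable, so division by g reduces the
  -- claim to germs on H, of smaller dimension.
  obtain ⟨H, hH⟩ := Submodule.exists_isCompl (Submodule.span ℂ {v})
  let e : (H × ℂ) ≃L[ℂ] E := (((LinearEquiv.refl ℂ H).prodCongr
    (LinearEquiv.toSpanNonzeroSingleton ℂ E v hv0)).trans
      (Submodule.prodEquivOfIsCompl H _ hH.symm)).toContinuousLinearEquiv
  have he : ∀ p : H × ℂ, e p = (p.1 : E) + p.2 • v := fun p => rfl
  have hdim : Module.finrank ℂ H < d := by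
    have := e.toLinearEquiv.finrank_eq
    rw [Module.finrank_prod, Module.finrank_self, hd] at this
    omega
  have := ih _ hdim H 0 rfl
  have hcoe : AnalyticAt ℂ (fun p : H × ℂ => x + e p) 0 :=
    analyticAt_const.add ((e : (H × ℂ) →L[ℂ] E).analyticAt 0)
  have hinv : AnalyticAt ℂ (fun y : E => e.symm (y - x)) x :=
    ((e.symm : E →L[ℂ] (H × ℂ)).analyticAt _).fun_comp (analyticAt_id.sub analyticAt_const)
  have hinv0 : e.symm (x - x) = 0 := by simp
  have hfst : AnalyticAt ℂ (fun y : E => (e.symm (y - x)).1) x :=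
    analyticAt_fst.fun_comp hinv
  have hsnd : AnalyticAt ℂ (fun y : E => (e.symm (y - x)).2) x :=
    analyticAt_snd.fun_comp hinv
  have hpull : ∀ {f : E → ℂ}, AnalyticAt ℂ f x → AnalyticAt ℂ (fun p : H × ℂ => f (x + e p)) 0 :=
    fun {f} hf => AnalyticAt.fun_comp (by simpa using hf) hcoe
  have hline : AnalyticAt ℂ (fun t : ℂ => g (x + t • v)) 0 :=
    AnalyticAt.fun_comp (by simpa using hg)
      (analyticAt_const.add (analyticAt_id.smul analyticAt_const))
  obtain ⟨m, u, hu, hu0, hgu⟩ := hline.exists_eventuallyEq_pow_smul_nonzero_iff.2 hv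
  refine isNoetherianRing_quotient_of_division
    (comap (x := (0 : H)) (fun y : E => (e.symm (y - x)).1) hfst (by simp))
    _ (⟨((fun y : E => (e.symm (y - x)).2) : Germ (𝓝 x) ℂ), _, hsnd, rfl⟩ : analyticGerms x) m ?_
  rintro ⟨_, f, hf, rfl⟩
  obtain ⟨q, r, hq, hr, hqr⟩ := exists_weierstrass_division (hpull hf) (hpull hg) hu hu0 (d := m)
    (by
      filter_upwards [hgu] with t ht
      simpa [he] using ht)
  refine ⟨⟨((fun y : E => q (e.symm (y - x))) : Germ (𝓝 x) ℂ), _,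
    AnalyticAt.fun_comp (by rwa [hinv0]) hinv, rfl⟩, fun k => ⟨(r k : Germ (𝓝 (0 : H)) ℂ), _, hr k,
      rfl⟩, Subtype.ext ?_⟩
  have hcont : Tendsto (fun y : E => e.symm (y - x)) (𝓝 x) (𝓝 0) := by
    have := hinv.continuousAt.tendsto
    rwa [hinv0] at this
  have hsum : ∀ s : Finset ℕ, ((∑ k ∈ s, comap (x := (0 : H))
      (fun y : E => (e.symm (y - x)).1) hfst (by simp) ⟨(r k : Germ (𝓝 (0 : H)) ℂ), _, hr k, rfl⟩ *
      (⟨((fun y : E => (e.symm (y - x)).2) : Germ (𝓝 x) ℂ), _, hsnd, rfl⟩ : analyticGerms x) ^ k :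
      analyticGerms x) : Germ (𝓝 x) ℂ) =
      ((fun y : E => ∑ k ∈ s, r k (e.symm (y - x)).1 * (e.symm (y - x)).2 ^ k : E → ℂ) :
        Germ (𝓝 x) ℂ) := by
    intro s
    classical
    induction s using Finset.induction_on with
    | empty => rfl
    | insert k s hk ih =>
      simp only [Finset.sum_insert hk]
      rw [Subring.coe_add, ih]
      rfl
  rw [Subring.coe_add, hsum]
  refine Germ.coe_eq.2 ?_
  filter_upwards [hcont.eventually hqr] with y hy
  simpa using hy

instance [FiniteDimensional ℂ E] : IsNoetherianRing (analyticGerms x) :=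
  isNoetherianRing_of_finrank_eq _ E x rfl

end analyticGerms

/-- Rückert's basis theorem: the ring of germs of holomorphic functions is Noetherian. -/
instance {n : ℕ} (x : Fin n → ℂ) : IsNoetherianRing (HolGerm x) :=
  inferInstanceAs (IsNoetherianRing (analyticGerms x))

/-! ### Orders of vanishing along S -/

section Order

variable {R : Type*} [CommRing R] {J P Q : Ideal R} [P.IsPrime]

/-- The local ring at `P` of the closed subscheme with ideal `Q`. -/
abbrev LocalRingAt (P Q : Ideal R) [P.IsPrime] : Type _ :=
  Localization.AtPrime P ⧸ Q.map (algebraMap R (Localization.AtPrime P))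

/-- The map from the ring to its local ring at `P` modulo `Q`. -/
def toLocalRingAt (P Q : Ideal R) [P.IsPrime] : R →+* LocalRingAt P Q :=
  (Ideal.Quotient.mk _).comp (algebraMap R (Localization.AtPrime P))

theorem disjoint_primeCompl (hQP : Q ≤ P) : Disjoint (P.primeCompl : Set R) (Q : Set R) :=
  Set.disjoint_left.2 fun _ h h' => h (hQP h')

theorem isDomain_localRingAt [Q.IsPrime] (hQP : Q ≤ P) : IsDomain (LocalRingAt P Q) := by
  have := IsLocalization.isPrime_of_isPrime_disjoint P.primeCompl (Localization.AtPrime P) Q ‹_›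
    (disjoint_primeCompl hQP)
  infer_instance

theorem toLocalRingAt_eq_zero_iff [Q.IsPrime] (hQP : Q ≤ P) {h : R} :
    toLocalRingAt P Q h = 0 ↔ h ∈ Q := by
  have := IsLocalization.under_map_of_isPrime_disjoint P.primeCompl (Localization.AtPrime P)
    (I := Q) ‹_› (disjoint_primeCompl hQP)
  rw [toLocalRingAt, RingHom.comp_apply, Ideal.Quotient.eq_zero_iff_mem]
  conv_rhs => rw [← this]
  rfl

/-- The ring is a quotient of the localisation of R / J at P / J, whose dimension is the height of P
/ J. -/
theorem krullDimLE_localRingAt (hJQ : J ≤ Q) (hQP : Q ≤ P)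
    (hht : (P.map (Ideal.Quotient.mk J)).height = 1) : Ring.KrullDimLE 1 (LocalRingAt P Q) := by
  have hprime : (P.map (Ideal.Quotient.mk J)).IsPrime :=
    Ideal.map_isPrime_of_surjective Ideal.Quotient.mk_surjective (by
      rw [Ideal.mk_ker]
      exact hJQ.trans hQP)
  have hdim := IsLocalization.AtPrime.ringKrullDim_eq_height (P.map (Ideal.Quotient.mk J))
    (Localization.AtPrime (P.map (Ideal.Quotient.mk J)))
  let ψ : R ⧸ J →+* LocalRingAt P Q := Ideal.Quotient.lift J (toLocalRingAt P Q) fun a ha =>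
    Ideal.Quotient.eq_zero_iff_mem.2 (Ideal.mem_map_of_mem _ (hJQ ha))
  have hψ : ∀ y : (P.map (Ideal.Quotient.mk J)).primeCompl, IsUnit (ψ y) := by
    rintro ⟨y, hy⟩
    obtain ⟨b, rfl⟩ := Ideal.Quotient.mk_surjective y
    have hb : b ∈ P.primeCompl := fun h => hy (Ideal.mem_map_of_mem _ h)
    exact (IsLocalization.map_units (Localization.AtPrime P) (⟨b, hb⟩ : P.primeCompl)).map
      (Ideal.Quotient.mk _)
  have hsurj : Function.Surjective (IsLocalization.lift
      (S := Localization.AtPrime (P.map (Ideal.Quotient.mk J))) hψ) := by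
    intro y
    obtain ⟨y, rfl⟩ := Ideal.Quotient.mk_surjective y
    obtain ⟨b, s, rfl⟩ := IsLocalization.exists_mk'_eq P.primeCompl y
    have hs : Ideal.Quotient.mk J s ∈ (P.map (Ideal.Quotient.mk J)).primeCompl := by
      intro h
      obtain ⟨t, ht, hts⟩ := (Ideal.mem_map_iff_of_surjective _ Ideal.Quotient.mk_surjective).1 h
      refine s.2 ?_
      have := P.sub_mem ht (hQP (hJQ (Ideal.Quotient.eq.1 hts)))
      simpa using this
    refine ⟨IsLocalization.mk' _ (Ideal.Quotient.mk J b) ⟨_, hs⟩, ?_⟩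
    rw [IsLocalization.lift_mk'_spec]
    change toLocalRingAt P Q b = toLocalRingAt P Q s * _
    rw [toLocalRingAt, RingHom.comp_apply, RingHom.comp_apply, ← map_mul,
      IsLocalization.mk'_spec']
  rw [Ring.krullDimLE_iff]
  refine (ringKrullDim_le_of_surjective _ hsurj).trans ?_
  rw [hdim, hht]
  rfl

/-- A minimal prime over J has height 0 in R / J. -/
theorem ne_of_height_map_eq_one (hQ : Q ∈ J.minimalPrimes)
    (hht : (P.map (Ideal.Quotient.mk J)).height = 1) : Q ≠ P := by
  rintro rfl
  have hmin : Q.map (Ideal.Quotient.mk J) ∈ minimalPrimes (R ⧸ J) := by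
    have h := Ideal.minimalPrimes_map_of_surjective (Ideal.Quotient.mk_surjective (I := J)) J
    rw [Ideal.map_quotient_self, Ideal.mk_ker, sup_idem] at h
    change _ ∈ (⊥ : Ideal (R ⧸ J)).minimalPrimes
    rw [h]
    exact Set.mem_image_of_mem _ hQ
  have : (Q.map (Ideal.Quotient.mk J)).IsPrime := hmin.1.1
  rw [Ideal.height_eq_zero_iff.2 hmin] at hht
  exact zero_ne_one hht

variable [IsNoetherianRing R] [Q.IsPrime]

theorem ord_localRingAt_ne_top (hJQ : J ≤ Q) (hQP : Q ≤ P)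
    (hht : (P.map (Ideal.Quotient.mk J)).height = 1) {h : R} (hh : h ∉ Q) :
    Ring.ord (LocalRingAt P Q) (toLocalRingAt P Q h) ≠ ⊤ := by
  have := isDomain_localRingAt hQP
  have := krullDimLE_localRingAt hJQ hQP hht
  have : IsNoetherianRing (Localization.AtPrime P) :=
    IsLocalization.isNoetherianRing P.primeCompl _ inferInstance
  exact Ring.ord_ne_top (mem_nonZeroDivisors_of_ne_zero
    (mt (toLocalRingAt_eq_zero_iff hQP).1 hh))

theorem toNat_ord_localRingAt_mul (hJQ : J ≤ Q) (hQP : Q ≤ P)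
    (hht : (P.map (Ideal.Quotient.mk J)).height = 1) {h h' : R} (hh : h ∉ Q) (hh' : h' ∉ Q) :
    (Ring.ord (LocalRingAt P Q) (toLocalRingAt P Q (h * h'))).toNat =
      (Ring.ord (LocalRingAt P Q) (toLocalRingAt P Q h)).toNat +
        (Ring.ord (LocalRingAt P Q) (toLocalRingAt P Q h')).toNat := by
  have := isDomain_localRingAt hQP
  rw [map_mul, Ring.ord_mul _ (mem_nonZeroDivisors_of_ne_zero
    (mt (toLocalRingAt_eq_zero_iff hQP).1 hh')), ENat.toNat_add
      (ord_localRingAt_ne_top hJQ hQP hht hh) (ord_localRingAt_ne_top hJQ hQP hht hh')]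

/-- Orders of the factors in a congruence `g a ≡ ξ u Δ` modulo `Q`, with `u` a unit. -/
theorem toNat_ord_sub_eq_of_mul_sub_mul_mem (hJQ : J ≤ Q) (hQP : Q ≤ P)
    (hht : (P.map (Ideal.Quotient.mk J)).height = 1) {g a ξ u Δ : R} (hu : IsUnit u)
    (hg : g ∉ Q) (ha : a ∉ Q) (hΔ : Δ ∉ Q) (h : g * a - ξ * (u * Δ) ∈ Q) :
    ((Ring.ord (LocalRingAt P Q) (toLocalRingAt P Q ξ)).toNat : ℤ) -
        (Ring.ord (LocalRingAt P Q) (toLocalRingAt P Q g)).toNat =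
      (Ring.ord (LocalRingAt P Q) (toLocalRingAt P Q a)).toNat -
        (Ring.ord (LocalRingAt P Q) (toLocalRingAt P Q Δ)).toNat := by
  -- Needed for additivity after `toNat`, which would send an infinite order to 0.
  have hξ : ξ ∉ Q := fun hξ => by
    have h1 : g * a ∈ Q := by simpa using Q.add_mem h (Q.mul_mem_right (u * Δ) hξ)
    exact (Ideal.IsPrime.mem_or_mem ‹_› h1).elim hg ha
  have e1 := toNat_ord_localRingAt_mul hJQ hQP hht hg ha
  have e2 := toNat_ord_localRingAt_mul hJQ hQP hht hξ
    (h' := u * Δ) (fun h => hΔ ((Ideal.unit_mul_mem_iff_mem Q hu).1 h))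
  have e3 : toLocalRingAt P Q (g * a) = toLocalRingAt P Q (ξ * (u * Δ)) := by
    rw [← sub_eq_zero, ← map_sub]
    exact (toLocalRingAt_eq_zero_iff hQP).2 h
  have e4 : Ring.ord (LocalRingAt P Q) (toLocalRingAt P Q (u * Δ)) =
      Ring.ord (LocalRingAt P Q) (toLocalRingAt P Q Δ) := by
    rw [map_mul, Ring.ord_mul_of_isUnit_left (hu.map _)]
  rw [e3, e2, e4] at e1
  omega

end Order

/-! ### Alternating forms -/

section LinearAlgebra

variable {n r : ℕ}

theorem wedge_apply (ℓ : Fin r → ((Fin n → ℂ) →ₗ[ℂ] ℂ)) (v : Fin r → Fin n → ℂ) :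
    wedge ℓ v = (Matrix.of fun i j => ℓ j (v i)).det := rfl

/-- The tuple of standard basis vectors with multi-index `J`. -/
def stdTuple (J : Fin r → Fin n) : Fin r → Fin n → ℂ := fun i => Pi.single (J i) 1

theorem wedgeD_stdTuple (f : Fin r → (Fin n → ℂ) → ℂ) (z : Fin n → ℂ) (J : Fin r ↪o Fin n) :
    wedgeD f z (stdTuple J) = jacMinor f J z := by
  rw [wedgeD, wedge_apply, jacMinor, ← Matrix.det_transpose]
  rfl

theorem dZ_stdTuple (I J : Fin r ↪o Fin n) :
    dZ I (stdTuple J) = if I = J then 1 else 0 := by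
  rw [dZ, wedge_apply]
  split_ifs with h
  · subst h
    convert Matrix.det_one (n := Fin r) (R := ℂ)
    ext i j
    simp [stdTuple, Matrix.one_apply, Pi.single_apply, eq_comm]
  -- Distinct increasing multi-indices of equal length have distinct ranges, so the matrix has a
  -- zero row.
  · have : ∃ i, J i ∉ Set.range I := by
      by_contra! hc
      have hsub : Finset.univ.image J ⊆ Finset.univ.image I := by
        intro y hy
        obtain ⟨i, -, rfl⟩ := Finset.mem_image.1 hy
        obtain ⟨k, hk⟩ := hc i
        exact Finset.mem_image.2 ⟨k, Finset.mem_univ _, hk⟩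
      have heq := Finset.eq_of_subset_of_card_le hsub (by
        rw [Finset.card_image_of_injective _ I.injective,
          Finset.card_image_of_injective _ J.injective])
      have hr : Set.range I = Set.range J := by
        have := congrArg (fun s : Finset (Fin n) => (s : Set (Fin n))) heq
        simpa using this.symm
      exact h (DFunLike.coe_injective ((StrictMono.range_inj I.strictMono J.strictMono).1 hr))
    obtain ⟨i, hi⟩ := this
    refine Matrix.det_eq_zero_of_row_eq_zero i fun j => ?_
    have : I j ≠ J i := fun h => hi ⟨j, h⟩
    simp [stdTuple, this]

theorem alternatingMap_sum_apply {ι κ M N : Type*} [AddCommGroup M] [Module ℂ M]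
    [AddCommGroup N] [Module ℂ N] (s : Finset κ) (L : κ → M [⋀^ι]→ₗ[ℂ] N) (v : ι → M) :
    (∑ k ∈ s, L k) v = ∑ k ∈ s, L k v :=
  map_sum (⟨⟨fun L : M [⋀^ι]→ₗ[ℂ] N => L v, rfl⟩, fun _ _ => rfl⟩ : (M [⋀^ι]→ₗ[ℂ] N) →+ N) L s

/-- An alternating form is the combination of the `dZ_J` whose coefficients are its values on
increasing tuples of standard basis vectors. -/
theorem eq_sum_smul_dZ (L : (Fin n → ℂ) [⋀^Fin r]→ₗ[ℂ] ℂ) :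
    L = ∑ J : Fin r ↪o Fin n, L (stdTuple J) • dZ J := by
  have hinc : ∀ J : Fin r ↪o Fin n,
      L (stdTuple J) = (∑ J : Fin r ↪o Fin n, L (stdTuple J) • dZ J) (stdTuple J) := by
    intro J
    simp [alternatingMap_sum_apply, dZ_stdTuple]
  refine Module.Basis.ext_alternating (Pi.basisFun ℂ (Fin n)) fun v hv => ?_
  -- Sorting v reduces to increasing tuples; both sides acquire the same sign, which cancels.
  let σ := Tuple.sort v
  have hs : StrictMono (v ∘ σ) :=
    (Tuple.monotone_sort v).strictMono_of_injective (hv.comp σ.injective)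
  have h := hinc (OrderEmbedding.ofStrictMono _ hs)
  have e : stdTuple (OrderEmbedding.ofStrictMono _ hs) =
      (fun i => Pi.basisFun ℂ (Fin n) (v i)) ∘ σ := by
    ext i
    simp [stdTuple]
  rw [e, AlternatingMap.map_perm, AlternatingMap.map_perm] at h
  exact (smul_right_inj (Units.ne_zero _ : (Equiv.Perm.sign σ : ℤ) ≠ 0)).1 h

/-- The entries are replaced one at a time, each replacement changing the value by a term with an
entry in K. -/
theorem map_eq_map_of_sub_mem {ι M N : Type*} [Finite ι] [AddCommGroup M] [Module ℂ M]
    [AddCommGroup N] [Module ℂ N] (L : M [⋀^ι]→ₗ[ℂ] N) (K : Submodule ℂ M)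
    (hL : ∀ v, (∃ i, v i ∈ K) → L v = 0) {v w : ι → M} (h : ∀ i, v i - w i ∈ K) : L v = L w := by
  classical
  have := Fintype.ofFinite ι
  have key : ∀ s : Finset ι, L (s.piecewise v w) = L w := by
    intro s
    induction s using Finset.induction_on with
    | empty => simp
    | insert i s hi ih =>
      rw [← ih, Finset.piecewise_insert, ← sub_eq_zero]
      have e : s.piecewise v w = Function.update (s.piecewise v w) i (w i) := by
        rw [eq_comm, Function.update_eq_self_iff, Finset.piecewise_eq_of_notMem _ _ _ hi]
      nth_rewrite 2 [e]
      rw [← AlternatingMap.map_update_sub]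
      exact hL _ ⟨i, by simpa using h i⟩
  simpa using key Finset.univ

/-- A form killed by the common kernel of independent linear forms is a multiple of their exterior
product. -/
theorem exists_eq_smul_wedge (ℓ : Fin r → ((Fin n → ℂ) →ₗ[ℂ] ℂ)) (hℓ : wedge ℓ ≠ 0)
    (L : (Fin n → ℂ) [⋀^Fin r]→ₗ[ℂ] ℂ) (hL : ∀ v, (∃ i, ∀ j, ℓ j (v i) = 0) → L v = 0) :
    ∃ c : ℂ, L = c • wedge ℓ := by
  have hsurj : (LinearMap.pi ℓ).range = ⊤ := by
    obtain ⟨v, hv⟩ : ∃ v, wedge ℓ v ≠ 0 := by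
      by_contra! h
      exact hℓ (AlternatingMap.ext h)
    rw [wedge_apply] at hv
    rw [LinearMap.range_eq_top]
    intro y
    refine ⟨∑ i, (Matrix.vecMul y (Matrix.of fun i j => ℓ j (v i))⁻¹) i • v i, ?_⟩
    have h1 : Matrix.vecMul (Matrix.vecMul y (Matrix.of fun i j => ℓ j (v i))⁻¹)
        (Matrix.of fun i j => ℓ j (v i)) = y := by
      rw [Matrix.vecMul_vecMul, Matrix.nonsing_inv_mul _ (isUnit_iff_ne_zero.2 hv),
        Matrix.vecMul_one]
    ext j
    nth_rewrite 2 [← h1]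
    simp [Matrix.vecMul, dotProduct]
  -- Modulo the common kernel, v is s (ℓ v). So L is the pull-back under ℓ of a top form on ℂ^r,
  -- that is, of a multiple of the determinant.
  obtain ⟨s, hs⟩ := LinearMap.exists_rightInverse_of_surjective _ hsurj
  have hs' : ∀ y, LinearMap.pi ℓ (s y) = y := fun y => LinearMap.congr_fun hs y
  refine ⟨L (s ∘ Pi.basisFun ℂ (Fin r)), AlternatingMap.ext fun v => ?_⟩
  have h1 : L v = L (fun i => s (LinearMap.pi ℓ (v i))) := by
    refine map_eq_map_of_sub_mem L (LinearMap.pi ℓ).ker (fun v ⟨i, hi⟩ => hL v ⟨i, fun j => ?_⟩)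
      fun i => ?_
    · exact congrFun (LinearMap.mem_ker.1 hi) j
    · rw [LinearMap.mem_ker, map_sub, hs', sub_self]
  rw [h1]
  have h2 := AlternatingMap.congr_fun
    (AlternatingMap.eq_smul_basis_det (Pi.basisFun ℂ (Fin r)) (L.compLinearMap s))
    fun i => LinearMap.pi ℓ (v i)
  rw [Pi.basisFun_det] at h2
  exact h2

theorem wedge_eq_det_smul {ℓ ℓ' : Fin r → ((Fin n → ℂ) →ₗ[ℂ] ℂ)} (M : Matrix (Fin r) (Fin r) ℂ)
    (h : ∀ i, ℓ' i = ∑ j, M i j • ℓ j) : wedge ℓ' = M.det • wedge ℓ := by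
  refine AlternatingMap.ext fun v => ?_
  rw [AlternatingMap.smul_apply, wedge_apply, wedge_apply, smul_eq_mul, mul_comm,
    ← Matrix.det_transpose M, ← Matrix.det_mul]
  congr 1
  ext i j
  simp [Matrix.mul_apply, h, mul_comm]

end LinearAlgebra

/-! ### Germs and change of local equation -/

section Analysis

variable {n r : ℕ} {x : Fin n → ℂ}

/-- The terms of the product rule that differentiate M carry a factor f_j(z) = 0. -/
theorem fderiv_sum_mul_of_eq_zero {M f : Fin r → (Fin n → ℂ) → ℂ} {z : Fin n → ℂ}
    (hM : ∀ j, DifferentiableAt ℂ (M j) z) (hf : ∀ j, DifferentiableAt ℂ (f j) z)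
    (h0 : ∀ j, f j z = 0) :
    fderiv ℂ (fun y => ∑ j, M j y * f j y) z = ∑ j, M j z • fderiv ℂ (f j) z := by
  rw [fderiv_fun_sum fun j _ => (hM j).fun_mul (hf j)]
  refine Finset.sum_congr rfl fun j _ => ?_
  rw [fderiv_fun_mul (hM j) (hf j), h0]
  ext v
  simp

theorem eventually_wedgeD_eq_det_smul {f f' : Fin r → (Fin n → ℂ) → ℂ}
    {M : Fin r → Fin r → (Fin n → ℂ) → ℂ} (hf : ∀ j, AnalyticAt ℂ (f j) x)
    (hM : ∀ i j, AnalyticAt ℂ (M i j) x)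
    (h : ∀ᶠ z in 𝓝 x, ∀ i, f' i z = ∑ j, M i j z * f j z) :
    ∀ᶠ z in 𝓝 x, (∀ j, f j z = 0) →
      wedgeD f' z = (Matrix.of fun i j => M i j z).det • wedgeD f z := by
  filter_upwards [h.eventually_nhds, eventually_all.2 fun j => (hf j).eventually_analyticAt,
    eventually_all.2 fun i => eventually_all.2 fun j => (hM i j).eventually_analyticAt]
    with z hz hfz hMz h0
  refine wedge_eq_det_smul _ fun i => ?_
  have h1 : f' i =ᶠ[𝓝 z] fun y => ∑ j, M i j y * f j y := hz.mono fun y hy => hy i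
  rw [h1.fderiv_eq, fderiv_sum_mul_of_eq_zero (fun j => (hMz i j).differentiableAt)
    (fun j => (hfz j).differentiableAt) h0]
  ext v
  simp

theorem germ_eq_germ_iff {h h' : (Fin n → ℂ) → ℂ} (hh : AnalyticAt ℂ h x)
    (hh' : AnalyticAt ℂ h' x) : germ h hh = germ h' hh' ↔ ∀ᶠ z in 𝓝 x, h z = h' z := by
  exact Subtype.ext_iff.trans Germ.coe_eq

theorem germ_mem_vanishingIdeal_iff {A : Set (Fin n → ℂ)} {h : (Fin n → ℂ) → ℂ}
    (hh : AnalyticAt ℂ h x) :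
    germ h hh ∈ vanishingIdeal x A ↔ ∀ᶠ z in 𝓝 x, z ∈ A → h z = 0 := by
  constructor
  · rintro ⟨h', e, hv⟩
    filter_upwards [Germ.coe_eq.1 e, hv] with z h1 h2 hz
    rw [h1, h2 hz]
  · exact fun hv => ⟨h, rfl, hv⟩

theorem exists_germ_eq (φ : HolGerm x) : ∃ h, ∃ hh : AnalyticAt ℂ h x, germ h hh = φ := by
  obtain ⟨_, h, hh, rfl⟩ := φ
  exact ⟨h, hh, rfl⟩

theorem germ_sum_mul {c f : Fin r → (Fin n → ℂ) → ℂ} (hc : ∀ i, AnalyticAt ℂ (c i) x)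
    (hf : ∀ i, AnalyticAt ℂ (f i) x) :
    ∑ i, germ (c i) (hc i) * germ (f i) (hf i) = germ (fun z => ∑ i, c i z * f i z)
      (Finset.analyticAt_fun_sum _ fun i _ => (hc i).mul (hf i)) := by
  classical
  suffices ∀ s : Finset (Fin r), ∑ i ∈ s, germ (c i) (hc i) * germ (f i) (hf i) =
      germ (fun z => ∑ i ∈ s, c i z * f i z)
      (Finset.analyticAt_fun_sum _ fun i _ => (hc i).mul (hf i)) from this _
  intro s
  induction s using Finset.induction_on with
  | empty => rfl
  | insert i s hi ih =>
    simp only [Finset.sum_insert hi]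
    rw [ih]
    rfl

/-- A function vanishing on `V` is, near `x`, a combination of the local equations. -/
theorem IsLocalEquation.exists_eq_sum {V : Set (Fin n → ℂ)} {f : Fin r → (Fin n → ℂ) → ℂ}
    {hf : ∀ i, AnalyticAt ℂ (f i) x} (hV : IsLocalEquation x V f hf) {h : (Fin n → ℂ) → ℂ}
    (hh : AnalyticAt ℂ h x) (hv : ∀ᶠ z in 𝓝 x, z ∈ V → h z = 0) :
    ∃ c : Fin r → (Fin n → ℂ) → ℂ, (∀ i, AnalyticAt ℂ (c i) x) ∧
      ∀ᶠ z in 𝓝 x, h z = ∑ i, c i z * f i z := by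
  have h1 := (germ_mem_vanishingIdeal_iff hh).2 hv
  rw [hV.2, Ideal.mem_span_range_iff_exists_fun] at h1
  obtain ⟨φ, hφ⟩ := h1
  choose c hc hcφ using fun i => exists_germ_eq (φ i)
  refine ⟨c, hc, ?_⟩
  simp only [← hcφ, germ_sum_mul] at hφ
  exact ((germ_eq_germ_iff _ _).1 hφ).mono fun z hz => hz.symm

/-- Two local equations of `V` are related by a matrix of holomorphic functions. -/
theorem IsLocalEquation.exists_matrix {V : Set (Fin n → ℂ)} {f f' : Fin r → (Fin n → ℂ) → ℂ}
    {hf : ∀ i, AnalyticAt ℂ (f i) x} {hf' : ∀ i, AnalyticAt ℂ (f' i) x}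
    (hV : IsLocalEquation x V f hf) (hV' : IsLocalEquation x V f' hf') :
    ∃ M : Fin r → Fin r → (Fin n → ℂ) → ℂ, (∀ i j, AnalyticAt ℂ (M i j) x) ∧
      ∀ᶠ z in 𝓝 x, ∀ i, f' i z = ∑ j, M i j z * f j z := by
  choose M hM hMe using fun i => hV.exists_eq_sum (hf' i)
    (hV'.1.mono fun z hz hzV => hz.1 hzV i)
  exact ⟨M, hM, eventually_all.2 hMe⟩

theorem analyticAt_det {M : Fin r → Fin r → (Fin n → ℂ) → ℂ} (hM : ∀ i j, AnalyticAt ℂ (M i j) x) :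
    AnalyticAt ℂ (fun z => (Matrix.of fun i j => M i j z).det) x := by
  simp only [Matrix.det_apply, Units.smul_def, zsmul_eq_mul, Matrix.of_apply]
  exact Finset.analyticAt_fun_sum _ fun σ _ =>
    analyticAt_const.mul (Finset.analyticAt_fun_prod _ fun i _ => hM _ _)

theorem isUnit_germ {h : (Fin n → ℂ) → ℂ} (hh : AnalyticAt ℂ h x) (h0 : h x ≠ 0) :
    IsUnit (germ h hh) :=
  analyticGerms.isUnit_of_ne_zero hh h0

end Analysis

/-! ### Decompositions and the GSV index -/

section Index

variable {n r : ℕ} {x : Fin n → ℂ} {V S : Set (Fin n → ℂ)}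
  {ω : (Fin n → ℂ) → (Fin n → ℂ) [⋀^Fin r]→ₗ[ℂ] ℂ} {a : (Fin r ↪o Fin n) → (Fin n → ℂ) → ℂ}
  {f : Fin r → (Fin n → ℂ) → ℂ}

theorem sum_smul_dZ_stdTuple (c : (Fin r ↪o Fin n) → ℂ) (J : Fin r ↪o Fin n) :
    (∑ I, c I • dZ I) (stdTuple J) = c J := by
  simp [alternatingMap_sum_apply, dZ_stdTuple]

/-- On an invariant variety the coefficients of the form are proportional to the minors. -/
theorem IsInvariant.eventually_mul_sub_mul_eq_zero (hinv : IsInvariant x ω V f)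
    (hω : ∀ᶠ z in 𝓝 x, ω z = ∑ J, a J z • dZ J) (I J : Fin r ↪o Fin n) :
    ∀ᶠ z in 𝓝 x, z ∈ V → jacMinor f I z * a J z - a I z * jacMinor f J z = 0 := by
  filter_upwards [hinv, hω] with z hz hωz hzV
  -- Where df₁ ∧ ⋯ ∧ df_r vanishes, all minors vanish and both terms are zero; elsewhere ω is a
  -- multiple of it.
  by_cases h : wedgeD f z = 0
  · rw [← wedgeD_stdTuple, ← wedgeD_stdTuple, h]
    simp
  · obtain ⟨c, hc⟩ := exists_eq_smul_wedge _ h (ω z) (hz hzV h)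
    have hJ : ∀ J, a J z = c * jacMinor f J z := by
      intro J
      rw [← sum_smul_dZ_stdTuple (fun J => a J z) J, ← hωz, hc, ← wedgeD_stdTuple]
      rfl
    rw [hJ I, hJ J]
    ring

/-- Since the f_i generate the ideal of V, Δ_I a_J - a_I Δ_J = ∑ c_{J,i} f_i, and η_i = ∑ c_{J,i}
dZ_J. -/
theorem IsInvariant.isDecomposition {hf : ∀ i, AnalyticAt ℂ (f i) x}
    (hinv : IsInvariant x ω V f) (hV : IsLocalEquation x V f hf)
    (ha : ∀ J, AnalyticAt ℂ (a J) x)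
    (hω : ∀ᶠ z in 𝓝 x, ω z = ∑ J, a J z • dZ J) (I : Fin r ↪o Fin n) :
    IsDecomposition x ω f (jacMinor f I) (a I) := by
  choose c hc hce using fun J => hV.exists_eq_sum
    (((analyticAt_jacMinor hf I).fun_mul (ha J)).fun_sub
      ((ha I).fun_mul (analyticAt_jacMinor hf J)))
    (hinv.eventually_mul_sub_mul_eq_zero hω I J)
  refine ⟨fun i z => ∑ J, c J i z • dZ J, fun i v => ?_, ?_⟩
  · simp only [alternatingMap_sum_apply, AlternatingMap.smul_apply, smul_eq_mul]
    exact Finset.analyticAt_fun_sum _ fun J _ => (hc J i).mul analyticAt_const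
  · filter_upwards [hω, eventually_all.2 hce] with z hωz hz
    rw [eq_sum_smul_dZ (wedgeD f z), hωz]
    simp only [wedgeD_stdTuple, Finset.smul_sum, smul_smul]
    rw [Finset.sum_comm, ← Finset.sum_add_distrib]
    refine Finset.sum_congr rfl fun J _ => ?_
    rw [← Finset.sum_smul, ← add_smul]
    congr 1
    rw [sub_eq_iff_eq_add.1 (hz J), add_comm]
    congr 1
    exact Finset.sum_congr rfl fun i _ => mul_comm _ _

theorem IsInvariant.exists_isGSVIndex [(vanishingIdeal x S).IsPrime]
    {hf : ∀ i, AnalyticAt ℂ (f i) x} (hinv : IsInvariant x ω V f) (hV : IsLocalEquation x V f hf)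
    (ha : ∀ J, AnalyticAt ℂ (a J) x) (hω : ∀ᶠ z in 𝓝 x, ω z = ∑ J, a J z • dZ J)
    (I : Fin r ↪o Fin n)
    (hΔ : ∀ Q ∈ componentsThrough x V S, germ (jacMinor f I) (analyticAt_jacMinor hf I) ∉ Q) :
    ∃ m : ℤ, IsGSVIndex x ω V S m :=
  ⟨_, f, hf, jacMinor f I, a I, analyticAt_jacMinor hf I, ha I, hV,
    hinv.isDecomposition hV ha hω I, hΔ, rfl⟩

/-- Passing to another local equation multiplies the minors by a unit, modulo the ideal of `V`. -/
theorem exists_isUnit_jacMinor {f' : Fin r → (Fin n → ℂ) → ℂ} {hf : ∀ i, AnalyticAt ℂ (f i) x}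
    {hf' : ∀ i, AnalyticAt ℂ (f' i) x} (hV : IsLocalEquation x V f hf)
    (hV' : IsLocalEquation x V f' hf') {Q : Ideal (HolGerm x)} [Q.IsPrime]
    (hVQ : vanishingIdeal x V ≤ Q) (I : Fin r ↪o Fin n)
    (hΔ : germ (jacMinor f I) (analyticAt_jacMinor hf I) ∉ Q) :
    ∃ (u : (Fin n → ℂ) → ℂ) (hu : AnalyticAt ℂ u x), IsUnit (germ u hu) ∧
      ∀ᶠ z in 𝓝 x, z ∈ V → jacMinor f' I z = u z * jacMinor f I z := by
  obtain ⟨M, hM, hMe⟩ := hV.exists_matrix hV'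
  obtain ⟨N, hN, hNe⟩ := hV'.exists_matrix hV
  have key : ∀ᶠ z in 𝓝 x, z ∈ V →
      jacMinor f' I z = (Matrix.of fun i j => M i j z).det * jacMinor f I z ∧
      jacMinor f I z = (Matrix.of fun i j => N i j z).det * jacMinor f' I z := by
    filter_upwards [eventually_wedgeD_eq_det_smul hf hM hMe,
      eventually_wedgeD_eq_det_smul hf' hN hNe, hV.1, hV'.1] with z h1 h2 h3 h4 hz
    constructor
    · rw [← wedgeD_stdTuple, h1 (h3.1 hz), ← wedgeD_stdTuple]
      rfl
    · rw [← wedgeD_stdTuple, h2 (h4.1 hz), ← wedgeD_stdTuple]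
      rfl
  refine ⟨_, analyticAt_det hM, isUnit_germ _ fun h0 => ?_, key.mono fun z hz hzV => (hz hzV).1⟩
  -- Passing from f to f' and back gives (1 - det N det M) Δ_I = 0 on V. If det M vanished at x, the
  -- first factor would be a unit, forcing Δ_I into Q.
  have hw : AnalyticAt ℂ (fun z => 1 - (Matrix.of fun i j => N i j z).det *
      (Matrix.of fun i j => M i j z).det) x :=
    analyticAt_const.sub ((analyticAt_det hN).mul (analyticAt_det hM))
  have h1 : germ (jacMinor f I) (analyticAt_jacMinor hf I) * germ _ hw ∈ Q := by
    refine hVQ ((germ_mem_vanishingIdeal_iff ((analyticAt_jacMinor hf I).mul hw)).2 ?_)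
    filter_upwards [key] with z hz hzV
    obtain ⟨e1, e2⟩ := hz hzV
    rw [e1] at e2
    simp only [Pi.mul_apply]
    linear_combination e2
  have h2 : IsUnit (germ _ hw) := isUnit_germ hw (by simp [h0])
  exact (Ideal.IsPrime.mem_or_mem ‹_› h1).elim hΔ
    fun h => Ideal.IsPrime.ne_top ‹_› (Ideal.eq_top_of_isUnit_mem _ h h2)

theorem IsDecomposition.eventually_mul_eq {f' : Fin r → (Fin n → ℂ) → ℂ} {g ξ : (Fin n → ℂ) → ℂ}
    (hdec : IsDecomposition x ω f' g ξ) {hf' : ∀ i, AnalyticAt ℂ (f' i) x}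
    (hV' : IsLocalEquation x V f' hf') (hω : ∀ᶠ z in 𝓝 x, ω z = ∑ J, a J z • dZ J)
    (J : Fin r ↪o Fin n) : ∀ᶠ z in 𝓝 x, z ∈ V → g z * a J z = ξ z * jacMinor f' J z := by
  obtain ⟨η, -, hη⟩ := hdec
  filter_upwards [hη, hω, hV'.1] with z h1 h2 h3 hz
  have h4 := AlternatingMap.congr_fun h1 (stdTuple J)
  simp only [h3.1 hz, zero_smul, Finset.sum_const_zero, add_zero, AlternatingMap.smul_apply,
    wedgeD_stdTuple, smul_eq_mul] at h4
  rw [← h4, h2, sum_smul_dZ_stdTuple]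

theorem germ_mul {g h : (Fin n → ℂ) → ℂ} (hg : AnalyticAt ℂ g x) (hh : AnalyticAt ℂ h x) :
    germ g hg * germ h hh = germ (fun z => g z * h z) (hg.fun_mul hh) := rfl

theorem germ_sub {g h : (Fin n → ℂ) → ℂ} (hg : AnalyticAt ℂ g x) (hh : AnalyticAt ℂ h x) :
    germ g hg - germ h hh = germ (fun z => g z - h z) (hg.fun_sub hh) := rfl

/-- Let the minor `Δ_I` not vanish on the component `Q` of `V`. Then `g a_I` is `ξ Δ_I` up to a unit
on the component, and if `a_I` vanishes there, so do all the coefficients of `ω`. -/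
theorem IsDecomposition.exists_isUnit_and_forall_mem {f' : Fin r → (Fin n → ℂ) → ℂ}
    {g ξ : (Fin n → ℂ) → ℂ} (hdec : IsDecomposition x ω f' g ξ) {hf : ∀ i, AnalyticAt ℂ (f i) x}
    {hf' : ∀ i, AnalyticAt ℂ (f' i) x} (hV : IsLocalEquation x V f hf)
    (hV' : IsLocalEquation x V f' hf') (ha : ∀ J, AnalyticAt ℂ (a J) x)
    (hg : AnalyticAt ℂ g x) (hξ : AnalyticAt ℂ ξ x)
    (hω : ∀ᶠ z in 𝓝 x, ω z = ∑ J, a J z • dZ J) {Q : Ideal (HolGerm x)} [Q.IsPrime]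
    (hVQ : vanishingIdeal x V ≤ Q) (hgQ : germ g hg ∉ Q) (I : Fin r ↪o Fin n)
    (hΔ : germ (jacMinor f I) (analyticAt_jacMinor hf I) ∉ Q) :
    (∃ u, IsUnit u ∧ germ g hg * germ (a I) (ha I) - germ ξ hξ *
      (u * germ (jacMinor f I) (analyticAt_jacMinor hf I)) ∈ Q) ∧
    (germ (a I) (ha I) ∈ Q → ∀ J, germ (a J) (ha J) ∈ Q) := by
  obtain ⟨u, hu, hunit, hue⟩ := exists_isUnit_jacMinor hV hV' hVQ I hΔ
  have h1 : germ g hg * germ (a I) (ha I) - germ ξ hξ *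
      (germ u hu * germ (jacMinor f I) (analyticAt_jacMinor hf I)) ∈ Q := by
    simp only [germ_mul, germ_sub]
    refine hVQ ((germ_mem_vanishingIdeal_iff _).2 ?_)
    filter_upwards [hue, hdec.eventually_mul_eq hV' hω I] with z h2 h3 hz
    rw [h3 hz, h2 hz, sub_self]
  have h2 : ∀ J, germ g hg * germ (a J) (ha J) -
      germ ξ hξ * germ (jacMinor f' J) (analyticAt_jacMinor hf' J) ∈ Q := by
    intro J
    simp only [germ_mul, germ_sub]
    refine hVQ ((germ_mem_vanishingIdeal_iff _).2 ?_)
    filter_upwards [hdec.eventually_mul_eq hV' hω J] with z h3 hz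
    rw [h3 hz, sub_self]
  refine ⟨⟨_, hunit, h1⟩, fun haQ J => ?_⟩
  -- If a_I ∈ Q, then ξ u Δ_I ∈ Q, so ξ ∈ Q; then g a_J ∈ Q for every J, and g ∉ Q.
  have h3 := (Q.sub_mem_iff_right (Q.mul_mem_left _ haQ)).1 h1
  have hξQ : germ ξ hξ ∈ Q := (Ideal.IsPrime.mem_or_mem ‹_› h3).resolve_right
    fun h => hΔ ((Ideal.unit_mul_mem_iff_mem Q hunit).1 h)
  have h4 := (Q.sub_mem_iff_left (Q.mul_mem_right _ hξQ)).1 (h2 J)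
  exact (Ideal.IsPrime.mem_or_mem ‹_› h4).resolve_left hgQ

/-- The GSV index is the difference of the orders of a coefficient and of the minor. -/
theorem IsGSVIndex.eq_ordOn_sub_ordOn [hP : (vanishingIdeal x S).IsPrime] {m : ℤ}
    (hm : IsGSVIndex x ω V S m) {hf : ∀ i, AnalyticAt ℂ (f i) x} (hV : IsLocalEquation x V f hf)
    (ha : ∀ J, AnalyticAt ℂ (a J) x) (hω : ∀ᶠ z in 𝓝 x, ω z = ∑ J, a J z • dZ J)
    (hS : IsSingComponent x f hf a ha S) (hcodim : IsCodimOne x V S) (I : Fin r ↪o Fin n)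
    (hΔ : ∀ Q ∈ componentsThrough x V S, germ (jacMinor f I) (analyticAt_jacMinor hf I) ∉ Q) :
    (∀ Q ∈ componentsThrough x V S,
      ordAlong (vanishingIdeal x S) Q (germ (a I) (ha I)) ≠ ⊤ ∧
      ordAlong (vanishingIdeal x S) Q (germ (jacMinor f I) (analyticAt_jacMinor hf I)) ≠ ⊤) ∧
    m = ordOn x V S (germ (a I) (ha I)) -
      ordOn x V S (germ (jacMinor f I) (analyticAt_jacMinor hf I)) := by
  obtain ⟨f', hf', g, ξ, hg, hξ, hV', hdec, hgQ, rfl⟩ := hm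
  have key : ∀ Q ∈ componentsThrough x V S, Q.IsPrime ∧ vanishingIdeal x V ≤ Q ∧
      germ (a I) (ha I) ∉ Q ∧ ∃ u, IsUnit u ∧ germ g hg * germ (a I) (ha I) - germ ξ hξ *
        (u * germ (jacMinor f I) (analyticAt_jacMinor hf I)) ∈ Q := by
    intro Q hQ
    have hprime : Q.IsPrime := hQ.1.1.1
    have hVQ : vanishingIdeal x V ≤ Q := hQ.1.1.2
    obtain ⟨hu, hall⟩ :=
      hdec.exists_isUnit_and_forall_mem hV hV' ha hg hξ hω hVQ (hgQ Q hQ) I (hΔ Q hQ)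
    refine ⟨hprime, hVQ, fun h => ?_, hu⟩
    -- If a_I ∈ Q, then Q contains all the equations of Sing(ω) ∩ V, and minimality of the ideal of
    -- S makes the two primes equal.
    refine ne_of_height_map_eq_one hQ.1 hcodim (le_antisymm hQ.2 (hS.2 ⟨hprime, ?_⟩ hQ.2))
    refine sup_le (hV.2 ▸ hVQ) (Ideal.span_le.2 ?_)
    rintro _ ⟨J, rfl⟩
    exact hall h J
  refine ⟨fun Q hQ => ?_, ?_⟩
  · obtain ⟨hprime, hVQ, haQ, -⟩ := key Q hQ
    exact ⟨ord_localRingAt_ne_top hVQ hQ.2 hcodim haQ,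
      ord_localRingAt_ne_top hVQ hQ.2 hcodim (hΔ Q hQ)⟩
  -- Finiteness of the set of components lets `finsum` distribute over the difference.
  · have hfin : (componentsThrough x V S).Finite :=
      (Ideal.finite_minimalPrimes_of_isNoetherianRing _ _).subset fun Q hQ => hQ.1
    rw [ordOn, ordOn, ← finsum_mem_sub_distrib _ _ hfin]
    refine finsum_mem_congr rfl fun Q hQ => ?_
    obtain ⟨hprime, hVQ, haQ, u, hu, hmem⟩ := key Q hQ
    exact toNat_ord_sub_eq_of_mul_sub_mul_mem hVQ hQ.2 hcodim hu (hgQ Q hQ) haQ (hΔ Q hQ) hmem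

end Index

end Pfaff

end

theorem mainTheorem2 {n k : ℕ} (hk : k ≤ n)
    (U : Set (Fin n → ℂ)) (hU : IsOpen U) (x : Fin n → ℂ) (hx : x ∈ U)
    (V : Set (Fin n → ℂ))
    (f : Fin (n - k) → (Fin n → ℂ) → ℂ) (hf : ∀ i, AnalyticOnNhd ℂ (f i) U)
    (hV : Pfaff.IsLocalEquation x V f (fun i => hf i x hx))
    (ω : (Fin n → ℂ) → (Fin n → ℂ) [⋀^Fin (n - k)]→ₗ[ℂ] ℂ)
    (a : (Fin (n - k) ↪o Fin n) → (Fin n → ℂ) → ℂ) (ha : ∀ I, AnalyticOnNhd ℂ (a I) U)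
    (hω : ∀ z ∈ U, ω z = ∑ I, a I z • Pfaff.dZ I)
    (S : Set (Fin n → ℂ)) [(Pfaff.vanishingIdeal x S).IsPrime]
    (hS : Pfaff.IsSingComponent x f (fun i => hf i x hx) a (fun I => ha I x hx) S)
    (hcodim : Pfaff.IsCodimOne x V S)
    (I : Fin (n - k) ↪o Fin n)
    (hΔ : ∀ Q ∈ Pfaff.componentsThrough x V S,
      Pfaff.germ (Pfaff.jacMinor f I) (Pfaff.analyticAt_jacMinor (fun i => hf i x hx) I) ∉ Q) :
    (Pfaff.IsInvariant x ω V f → ∃ m : ℤ, Pfaff.IsGSVIndex x ω V S m) ∧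
    ∀ m : ℤ, Pfaff.IsGSVIndex x ω V S m →
      (∀ Q ∈ Pfaff.componentsThrough x V S,
        Pfaff.ordAlong (Pfaff.vanishingIdeal x S) Q (Pfaff.germ (a I) (ha I x hx)) ≠ ⊤ ∧
        Pfaff.ordAlong (Pfaff.vanishingIdeal x S) Q
          (Pfaff.germ (Pfaff.jacMinor f I)
            (Pfaff.analyticAt_jacMinor (fun i => hf i x hx) I)) ≠ ⊤) ∧
      m = Pfaff.ordOn x V S (Pfaff.germ (a I) (ha I x hx)) -
        Pfaff.ordOn x V S
          (Pfaff.germ (Pfaff.jacMinor f I)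
            (Pfaff.analyticAt_jacMinor (fun i => hf i x hx) I)) := by
  have hω' : ∀ᶠ z in 𝓝 x, ω z = ∑ I, a I z • Pfaff.dZ I := by
    filter_upwards [hU.mem_nhds hx] with z hz using hω z hz
  exact ⟨fun hinv => hinv.exists_isGSVIndex hV (fun J => ha J x hx) hω' I hΔ,
    fun m hm => hm.eq_ordOn_sub_ordOn hV (fun J => ha J x hx) hω' hS hcodim I hΔ⟩
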